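/- **Model.** There are $n$ nodes in an asynchronous network, at most $t\le (n-1)/3$ of which are Byzantine (arbitrary behaviour). Let $m\ge 0$, $\epsilon>0$, let $\mathsf{ex\_val}:\mathbb{R}^m\to\{\mathrm{true},\mathrm{false}\}$ be an arbitrary function that all nonfaulty nodes can evaluate, and use Euclidean distance. Each node has a broadcast channel on which a message carries a tag (its type and round number), such that: a nonfaulty node receives a broadcast from a nonfaulty node if and only if the latter sent it (after a finite but arbitrary delay); if one nonfaulty node receives a broadcast of some node, then every nonfaulty node eventually receives it; if two nonfaulty nodes receive broadcasts of the same node with the same tag, these are equal; each node receives a given broadcast at most once. Nonfaulty nodes follow the protocol, and a step that remains possible for a nonfaulty node is eventually taken. **Procedures.** For a finite multiset $A$ of points, $\mathsf{vote}(A)=\frac1{|A|}\sum_{v\in A}v$; $\mathsf{elim}_t(A)$ results from $A$ by removing $t$ times a pair of elements of maximal distance, ties being broken by any fixed deterministic rule; $\mathsf{diam}(A)$ is the maximal distance of two points of $A$. Inclusions and cardinalities below are those of multisets. **Protocol of a node with input $v^0$.** The node keeps a round number $r=0$, a value $halt=\infty$, a multiset $T=\emptyset$, and multisets $vals^s=\emptyset$,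 $reps^s=\emptyset$ for $s\ge 0$. Each event below is atomic, and each received message is accepted at most once. * *Always, until termination.* On receiving $(\text{init\_value},v)$ with $\mathsf{ex\_val}(v)=\mathrm{true}$, add $v$ to $vals^0$, and if now $|vals^0|=n-t$, broadcast $(\text{report},vals^0,0)$. On receiving $(\text{enough},e)$ with $e\in\mathbb{Z}$, add $e$ to $T$, and if now $|T|\ge n-t$, set $halt$ to the $(t+1)$-st smallest element of $T$. Messages of type value or report are stored until they can be accepted. * *Acceptance tests.* A message $(\text{report},A,s)$ can be accepted if $r\ge s$, $|A|\ge n-t$ and $A\subseteq vals^s$. A message $(\text{value},v,A,R,s)$ with $s\ge1$ can be accepted if $r\ge s$, $|A|\ge n-t$, $|R|\ge n-t$, every element of $R$ is contained in $A$, $A\subseteq vals^{s-1}$, $R\subseteq reps^{s-1}$, and $v\in\mathrm{conv}(\mathsf{elim}_t(A))$ if $s=1$, respectively $v=\mathsf{vote}(A)$ if $s>1$. * *Initialization.* Broadcast $(\text{init\_value},v^0)$. Then accept reports $(\text{report},A,0)$ by adding $A$ to $reps^0$. At the moment when $|reps^0|=n-t$, compute $v^1=\mathsf{vote}(\mathsf{elim}_t(vals^0))$,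 record $A^0=vals^0$ and $R^0=reps^0$, and broadcast $(\text{enough},\lceil\log_2(3\,\mathsf{diam}(vals^0)/\epsilon)\rceil+1)$, with the value $1$ in place of this number if the diameter is $0$. Once $|reps^0|\ge n-t$ and $|T|\ge n-t$, set $r=1$, broadcast $(\text{value},v^1,A^0,R^0,1)$ and enter the main loop. * *Main loop.* Accept messages $(\text{value},v,A,R,s)$ by adding $v$ to $vals^s$; if $s=r$ and now $|vals^r|=n-t$, broadcast $(\text{report},vals^r,r)$. Accept messages $(\text{report},A,s)$ by adding $A$ to $reps^s$; if $s=r$ and now $|reps^r|=n-t$, increase $r$ by $1$, put $v^r=\mathsf{vote}(vals^{r-1})$ and broadcast $(\text{value},v^r,vals^{r-1},reps^{r-1},r)$. When $r\ge halt$ the node leaves the loop (possibly after having processed some further messages), outputs $v^r$ and terminates. **Theorem.** If $t\le (n-1)/3$, this protocol is a Validated Byzantine Asynchronous $\epsilon$-Agreement protocol over $\mathbb{R}^m$ resilient to up to $t$ Byzantine nodes. That is, in every execution with at most $t$ Byzantine nodes: 1. (Termination) if the inputs $v$ of all nonfaulty nodes satisfy $\mathsf{ex\_val}(v)=\mathrm{true}$,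 then every nonfaulty node completes the protocol; 2. (Correctness) if nonfaulty nodes $i$ and $j$ complete the protocol with outputs $y_i,y_j$, then $\|y_i-y_j\|\le\epsilon$; 3. (Validity) every output of a nonfaulty node lies in $\mathrm{conv}\{v\in\mathbb{R}^m : \mathsf{ex\_val}(v)=\mathrm{true}\}$. -/

import Mathlib

/-! ## Asynchronous systems with Byzantine nodes and broadcast channels -/

/-- A (deterministic) protocol for `n` nodes that communicate by tagged broadcasts.
A node reacts to a received broadcast with `recv` and performs internal steps `step a`
whenever they are `enabled`; both return the new local state and the list of broadcasts
that the node sends. `output` is the value that the node has output, once it has completed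
the protocol. -/
structure BroadcastProtocol (n : ℕ) (Input Output Msg Tag State Action : Type) where
  tag : Msg → Tag
  start : Input → State
  recv : Fin n → Msg → State → State × List Msg
  enabled : Action → State → Prop
  step : Action → State → State × List Msg
  output : State → Option Output

/-- What can happen at one instant: node `i` receives the broadcast `M` of node `j`,
node `i` performs the internal step `a`, or nothing happens. -/
inductive NetEvent (n : ℕ) (Msg Action : Type) : Type
  | recv (i j : Fin n) (M : Msg)
  | act (i : Fin n) (a : Action)
  | idle

/-- An infinite history: the local states of the nodes at the times `0, 1, 2, …`, and the event
that takes place between time `k` and time `k + 1`. -/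
structure History (n : ℕ) (Msg State Action : Type) where
  state : ℕ → Fin n → State
  event : ℕ → NetEvent n Msg Action

/-- Node `i` receives the broadcast `M` from node `j` at time `k`. -/
def History.Receives {n : ℕ} {Msg State Action : Type} (E : History n Msg State Action)
    (k : ℕ) (i j : Fin n) (M : Msg) : Prop :=
  E.event k = .recv i j M

namespace BroadcastProtocol

/-- The new state and the broadcasts sent by node `i`, in local state `σ`, at a given event. -/
def react {n : ℕ} {Input Output Msg Tag State Action : Type}
    (P : BroadcastProtocol n Input Output Msg Tag State Action) (i : Fin n) (σ : State) :
    NetEvent n Msg Action → State × List Msg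
  | .recv i' j M => if i' = i then P.recv j M σ else (σ, [])
  | .act i' a => if i' = i then P.step a σ else (σ, [])
  | .idle => (σ, [])

/-- In the history `E`, node `j` sends the broadcast `M` at time `k`. -/
def Sends {n : ℕ} {Input Output Msg Tag State Action : Type}
    (P : BroadcastProtocol n Input Output Msg Tag State Action)
    (E : History n Msg State Action) (k : ℕ) (j : Fin n) (M : Msg) : Prop :=
  M ∈ (P.react j (E.state k j) (E.event k)).2

/-- In the history `E`, node `i` completes the protocol and outputs `y`. -/
def Outputs {n : ℕ} {Input Output Msg Tag State Action : Type}
    (P : BroadcastProtocol n Input Output Msg Tag State Action)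
    (E : History n Msg State Action) (i : Fin n) (y : Output) : Prop :=
  ∃ k, P.output (E.state k i) = some y

/-- `E` is an execution of `P` in which the nodes outside `faulty` participate with inputs `x`
and follow the protocol. Nothing is required of the faulty nodes, which influence the others
only through the broadcasts that these receive. Delays are finite but arbitrary. -/
structure IsExecution {n : ℕ} {Input Output Msg Tag State Action : Type}
    (P : BroadcastProtocol n Input Output Msg Tag State Action) (faulty : Finset (Fin n))
    (x : Fin n → Input) (E : History n Msg State Action) : Prop where
  /-- Nonfaulty nodes start in the initial state. -/
  starts : ∀ i ∉ faulty, E.state 0 i = P.start (x i)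
  /-- Nonfaulty nodes follow the protocol. -/
  follows : ∀ k, ∀ i ∉ faulty, E.state (k + 1) i = (P.react i (E.state k i) (E.event k)).1
  /-- Nonfaulty nodes only perform enabled internal steps. -/
  allowed : ∀ k, ∀ i ∉ faulty, ∀ a, E.event k = .act i a → P.enabled a (E.state k i)
  /-- An internal step of a nonfaulty node that stays enabled is eventually performed. -/
  fair : ∀ i ∉ faulty, ∀ a k, (∀ l ≥ k, P.enabled a (E.state l i)) →
    ∃ l ≥ k, E.event l = .act i a
  /-- Channel validity: what a nonfaulty node receives from a nonfaulty node was sent before. -/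
  validity_received : ∀ i ∉ faulty, ∀ j ∉ faulty, ∀ M k, E.Receives k i j M →
    ∃ l < k, P.Sends E l j M
  /-- Channel validity: what a nonfaulty node sends is received by every nonfaulty node. -/
  validity_sent : ∀ i ∉ faulty, ∀ j ∉ faulty, ∀ M k, P.Sends E k j M →
    ∃ l, E.Receives l i j M
  /-- Channel liveness. -/
  liveness : ∀ i ∉ faulty, ∀ i' ∉ faulty, ∀ j M k, E.Receives k i j M →
    ∃ l, E.Receives l i' j M
  /-- Channel uniqueness. -/
  uniqueness : ∀ i ∉ faulty, ∀ i' ∉ faulty, ∀ j M M' k k', E.Receives k i j M →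
    E.Receives k' i' j M' → P.tag M = P.tag M' → M = M'
  /-- A broadcast is received at most once by each nonfaulty node. -/
  once : ∀ i ∉ faulty, ∀ j M k k', E.Receives k i j M → E.Receives k' i j M → k = k'

end BroadcastProtocol

/-- `P` is a protocol for validated Byzantine asynchronous `ε`-agreement over `ℝ^m`, with external
validity function `exVal`, that is resilient to up to `t` Byzantine nodes. -/
def IsValidatedApproxAgreement {m n : ℕ} {Msg Tag State Action : Type}
    (P : BroadcastProtocol n (EuclideanSpace ℝ (Fin m)) (EuclideanSpace ℝ (Fin m))
      Msg Tag State Action)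
    (exVal : EuclideanSpace ℝ (Fin m) → Bool) (ε : ℝ) (t : ℕ) : Prop :=
  ∀ (faulty : Finset (Fin n)) (x : Fin n → EuclideanSpace ℝ (Fin m))
      (E : History n Msg State Action),
    faulty.card ≤ t → P.IsExecution faulty x E →
      -- Termination
      ((∀ i ∉ faulty, exVal (x i) = true) → ∀ i ∉ faulty, ∃ y, P.Outputs E i y) ∧
      -- Correctness
      (∀ i ∉ faulty, ∀ j ∉ faulty, ∀ y z, P.Outputs E i y → P.Outputs E j z → dist y z ≤ ε) ∧
      -- Validity
      (∀ i ∉ faulty, ∀ y, P.Outputs E i y → y ∈ convexHull ℝ {v | exVal v = true})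

/-! ## The geometric procedures -/

namespace ApproxAgreement

/-- The diameter of a finite multiset of points: the largest Euclidean distance. -/
noncomputable def diam {m : ℕ} (A : Multiset (EuclideanSpace ℝ (Fin m))) : ℝ :=
  Metric.diam {x | x ∈ A}

/-- `furthest` selects in every multiset of at least two points a pair of elements (a
sub-multiset of size two) of maximal distance. Ties are broken in an arbitrary but
deterministic way. -/
def IsFurthest {m : ℕ}
    (furthest : Multiset (EuclideanSpace ℝ (Fin m)) →
      EuclideanSpace ℝ (Fin m) × EuclideanSpace ℝ (Fin m)) : Prop :=
  ∀ A : Multiset (EuclideanSpace ℝ (Fin m)), 2 ≤ A.card →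
    {(furthest A).1, (furthest A).2} ≤ A ∧
      ∀ a ∈ A, ∀ b ∈ A, dist a b ≤ dist (furthest A).1 (furthest A).2

theorem exists_isFurthest (m : ℕ) :
    ∃ furthest : Multiset (EuclideanSpace ℝ (Fin m)) →
      EuclideanSpace ℝ (Fin m) × EuclideanSpace ℝ (Fin m), IsFurthest furthest := by
  classical
  have key : ∀ A : Multiset (EuclideanSpace ℝ (Fin m)),
      ∃ p : EuclideanSpace ℝ (Fin m) × EuclideanSpace ℝ (Fin m), 2 ≤ A.card →
        ({p.1, p.2} ≤ A ∧ ∀ a ∈ A, ∀ b ∈ A, dist a b ≤ dist p.1 p.2) := by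
    intro A
    by_cases hA : 2 ≤ A.card
    · let S : Finset (EuclideanSpace ℝ (Fin m) × EuclideanSpace ℝ (Fin m)) :=
        (A.toFinset ×ˢ A.toFinset).filter fun p => {p.1, p.2} ≤ A
      have hS : S.Nonempty := by
        obtain ⟨a, ha⟩ := Multiset.card_pos_iff_exists_mem.1 (by omega : 0 < A.card)
        obtain ⟨B, rfl⟩ := Multiset.exists_cons_of_mem ha
        have hB : 0 < B.card := by
          rw [Multiset.card_cons] at hA
          omega
        obtain ⟨b, hb⟩ := Multiset.card_pos_iff_exists_mem.1 hB
        obtain ⟨C, rfl⟩ := Multiset.exists_cons_of_mem hb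
        refine ⟨(a, b), Finset.mem_filter.2 ⟨Finset.mem_product.2 ⟨Multiset.mem_toFinset.2 ha,
          Multiset.mem_toFinset.2 (Multiset.mem_cons_of_mem hb)⟩, ?_⟩⟩
        exact Multiset.cons_le_cons _ (Multiset.cons_le_cons _ (Multiset.zero_le _))
      obtain ⟨p, hp, hmax⟩ := S.exists_max_image (fun p => dist p.1 p.2) hS
      refine ⟨p, fun _ => ⟨(Finset.mem_filter.1 hp).2, fun a ha b hb => ?_⟩⟩
      by_cases hab : a = b
      · rw [hab, dist_self]
        exact dist_nonneg
      · refine hmax (a, b) (Finset.mem_filter.2 ⟨Finset.mem_product.2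
          ⟨Multiset.mem_toFinset.2 ha, Multiset.mem_toFinset.2 hb⟩, ?_⟩)
        refine (Multiset.le_iff_subset (by simp [hab])).2 ?_
        intro c hc
        simp only [Multiset.insert_eq_cons, Multiset.mem_cons, Multiset.mem_singleton] at hc
        rcases hc with rfl | rfl <;> assumption
    · exact ⟨(0, 0), fun h => absurd h hA⟩
  choose f hf using key
  exact ⟨f, hf⟩

open Classical in
/-- Remove `t` times a furthest pair from the multiset `A`. -/
noncomputable def elim {m : ℕ}
    (furthest : Multiset (EuclideanSpace ℝ (Fin m)) →
      EuclideanSpace ℝ (Fin m) × EuclideanSpace ℝ (Fin m))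
    (t : ℕ) (A : Multiset (EuclideanSpace ℝ (Fin m))) : Multiset (EuclideanSpace ℝ (Fin m)) :=
  (fun B => B - {(furthest B).1, (furthest B).2})^[t] A

/-- The average of the points of `A`. -/
noncomputable def vote {m : ℕ} (A : Multiset (EuclideanSpace ℝ (Fin m))) :
    EuclideanSpace ℝ (Fin m) :=
  (A.card : ℝ)⁻¹ • A.sum

/-! ## The protocol -/

/-- The broadcasts. In `value v recVals recReps s` the vote `v` for round `s` is accompanied by
the values and reports of round `s - 1` from which it was computed. -/
inductive Msg (m : ℕ) : Type
  | initValue (v : EuclideanSpace ℝ (Fin m))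
  | enough (e : ℤ)
  | value (v : EuclideanSpace ℝ (Fin m)) (recVals : Multiset (EuclideanSpace ℝ (Fin m)))
      (recReps : Multiset (Multiset (EuclideanSpace ℝ (Fin m)))) (s : ℕ)
  | report (recVals : Multiset (EuclideanSpace ℝ (Fin m))) (s : ℕ)

/-- A tag consists of the type of the message and the round number. -/
inductive Tag : Type
  | initValue
  | enough
  | value (s : ℕ)
  | report (s : ℕ)

/-- The tag of a broadcast. -/
def Msg.tag {m : ℕ} : Msg m → Tag
  | .initValue _ => .initValue
  | .enough _ => .enough
  | .value _ _ _ s => .value s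
  | .report _ s => .report s

/-- The position in the code: not yet in the initialization, in the loop of the initialization,
in the main loop, or terminated. -/
inductive Phase : Type
  | start
  | init
  | main
  | done

/-- The local variables of a node. `waiting` holds the value and report messages waiting to be
processed, with their senders. `v r` is the vote of the node for round `r` (`v 0` is its input).
`initVals` and `initReps` are the contents of `vals 0` and `reps 0` from which the node
computed `v 1`. -/
structure State (m n : ℕ) where
  phase : Phase
  r : ℕ
  terminationTimes : Multiset ℤ
  halt : WithTop ℤ
  waiting : Set (Fin n × Msg m)
  vals : ℕ → Multiset (EuclideanSpace ℝ (Fin m))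
  reps : ℕ → Multiset (Multiset (EuclideanSpace ℝ (Fin m)))
  v : ℕ → EuclideanSpace ℝ (Fin m)
  initVals : Multiset (EuclideanSpace ℝ (Fin m))
  initReps : Multiset (Multiset (EuclideanSpace ℝ (Fin m)))

/-- The internal steps: begin the initialization; process a waiting message (of sender `j`);
leave the initialization and enter the main loop; leave the main loop, output and terminate. -/
inductive Action (m n : ℕ) : Type
  | begin
  | accept (j : Fin n) (M : Msg m)
  | enterMain
  | terminate

/-- The initial state with input `x`. -/
noncomputable def State.initial {m : ℕ} (n : ℕ) (x : EuclideanSpace ℝ (Fin m)) : State m n where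
  phase := .start
  r := 0
  terminationTimes := 0
  halt := ⊤
  waiting := ∅
  vals := fun _ => 0
  reps := fun _ => 0
  v := fun _ => x
  initVals := 0
  initReps := 0

/-- The estimated number of rounds. -/
noncomputable def enoughRounds {m : ℕ} (ε : ℝ) (A : Multiset (EuclideanSpace ℝ (Fin m))) : ℤ :=
  ⌈Real.logb 2 (3 * diam A / ε)⌉ + 1

/-- The test whether a value message is accepted. -/
def ValueMessageReady {m n : ℕ} (t : ℕ)
    (furthest : Multiset (EuclideanSpace ℝ (Fin m)) →
      EuclideanSpace ℝ (Fin m) × EuclideanSpace ℝ (Fin m))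
    (σ : State m n) (v : EuclideanSpace ℝ (Fin m))
    (recVals : Multiset (EuclideanSpace ℝ (Fin m)))
    (recReps : Multiset (Multiset (EuclideanSpace ℝ (Fin m)))) (s : ℕ) : Prop :=
  s ≤ σ.r ∧ n - t ≤ recVals.card ∧ n - t ≤ recReps.card ∧
    (∀ A ∈ recReps, A ≤ recVals) ∧ recVals ≤ σ.vals (s - 1) ∧ recReps ≤ σ.reps (s - 1) ∧
    ((s = 1 ∧ v ∈ convexHull ℝ {a | a ∈ elim furthest t recVals}) ∨
      (1 < s ∧ v = vote recVals))

/-- The test whether a report message is accepted. -/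
def ReportMessageReady {m n : ℕ} (t : ℕ) (σ : State m n)
    (recVals : Multiset (EuclideanSpace ℝ (Fin m))) (s : ℕ) : Prop :=
  s ≤ σ.r ∧ n - t ≤ recVals.card ∧ recVals ≤ σ.vals s

/-- The reaction to the receipt of a broadcast of node `j`. A terminated node does not react. -/
noncomputable def receive {m n : ℕ} (t : ℕ) (exVal : EuclideanSpace ℝ (Fin m) → Bool)
    (j : Fin n) (M : Msg m) (σ : State m n) : State m n × List (Msg m) :=
  match σ.phase, M with
  | .done, _ => (σ, [])
  | _, .initValue v =>
      if exVal v = true then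
        let A := v ::ₘ σ.vals 0
        ({ σ with vals := Function.update σ.vals 0 A },
          if A.card = n - t then [.report A 0] else [])
      else (σ, [])
  | _, .enough e =>
      let T := e ::ₘ σ.terminationTimes
      -- entry number `t` (counted from `0`) of the sorted list is the `t + 1`-st smallest
      ({ σ with
          terminationTimes := T
          halt := if n - t ≤ T.card then (((T.sort (· ≤ ·)).getD t 0 : ℤ) : WithTop ℤ)
            else σ.halt }, [])
  | _, .value v A R s => ({ σ with waiting := insert (j, .value v A R s) σ.waiting }, [])
  | _, .report A s => ({ σ with waiting := insert (j, .report A s) σ.waiting }, [])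

/-- When an internal step can be performed. The initialization loop only processes reports of
round `0`. As `r < halt` is tested only between two passes through the main loop, messages may
still be processed after `halt ≤ r` has become true. -/
def Enabled {m n : ℕ} (t : ℕ)
    (furthest : Multiset (EuclideanSpace ℝ (Fin m)) →
      EuclideanSpace ℝ (Fin m) × EuclideanSpace ℝ (Fin m)) (σ : State m n) :
    Action m n → Prop
  | .begin => σ.phase = .start
  | .accept j (.value v A R s) =>
      (j, .value v A R s) ∈ σ.waiting ∧ σ.phase = .main ∧ ValueMessageReady t furthest σ v A R s
  | .accept j (.report A s) =>
      (j, .report A s) ∈ σ.waiting ∧ ((σ.phase = .init ∧ s = 0) ∨ σ.phase = .main) ∧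
        ReportMessageReady t σ A s
  | .accept _ _ => False
  | .enterMain =>
      σ.phase = .init ∧ n - t ≤ σ.terminationTimes.card ∧ n - t ≤ (σ.reps 0).card
  | .terminate => σ.phase = .main ∧ σ.halt ≤ ((σ.r : ℤ) : WithTop ℤ)

/-- Accept a value message for round `s`. -/
noncomputable def acceptValue {m n : ℕ} (t : ℕ) (v : EuclideanSpace ℝ (Fin m)) (s : ℕ)
    (σ : State m n) : State m n × List (Msg m) :=
  let A := v ::ₘ σ.vals s
  ({ σ with vals := Function.update σ.vals s A },
    if s = σ.r ∧ A.card = n - t then [.report A s] else [])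

/-- Accept a report message for round `0` in the initialization. -/
noncomputable def acceptInitReport {m n : ℕ} (t : ℕ) (ε : ℝ)
    (furthest : Multiset (EuclideanSpace ℝ (Fin m)) →
      EuclideanSpace ℝ (Fin m) × EuclideanSpace ℝ (Fin m))
    (recVals : Multiset (EuclideanSpace ℝ (Fin m))) (σ : State m n) :
    State m n × List (Msg m) :=
  let R := recVals ::ₘ σ.reps 0
  if R.card = n - t then
    ({ σ with
        reps := Function.update σ.reps 0 R
        v := Function.update σ.v 1 (vote (elim furthest t (σ.vals 0)))
        initVals := σ.vals 0
        initReps := R }, [.enough (enoughRounds ε (σ.vals 0))])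
  else ({ σ with reps := Function.update σ.reps 0 R }, [])

/-- Accept a report message for round `s` in the main loop. -/
noncomputable def acceptMainReport {m n : ℕ} (t : ℕ)
    (recVals : Multiset (EuclideanSpace ℝ (Fin m))) (s : ℕ) (σ : State m n) :
    State m n × List (Msg m) :=
  let R := recVals ::ₘ σ.reps s
  if s = σ.r ∧ R.card = n - t then
    ({ σ with
        reps := Function.update σ.reps s R
        r := s + 1
        v := Function.update σ.v (s + 1) (vote (σ.vals s)) },
      [.value (vote (σ.vals s)) (σ.vals s) R (s + 1)])
  else ({ σ with reps := Function.update σ.reps s R }, [])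

/-- The effect of an internal step. -/
noncomputable def perform {m n : ℕ} (t : ℕ) (ε : ℝ)
    (furthest : Multiset (EuclideanSpace ℝ (Fin m)) →
      EuclideanSpace ℝ (Fin m) × EuclideanSpace ℝ (Fin m)) (a : Action m n)
    (σ : State m n) : State m n × List (Msg m) :=
  match a with
  | .begin => ({ σ with phase := .init }, [.initValue (σ.v 0)])
  | .accept j (.value v A R s) =>
      acceptValue t v s { σ with waiting := σ.waiting \ {(j, .value v A R s)} }
  | .accept j (.report A s) =>
      match σ.phase with
      | .init =>
          acceptInitReport t ε furthest A { σ with waiting := σ.waiting \ {(j, .report A s)} }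
      | _ => acceptMainReport t A s { σ with waiting := σ.waiting \ {(j, .report A s)} }
  | .accept _ _ => (σ, [])
  | .enterMain =>
      ({ σ with phase := .main, r := 1 }, [.value (σ.v 1) σ.initVals σ.initReps 1])
  | .terminate => ({ σ with phase := .done }, [])

/-- The protocol, for `n` nodes and the resilience threshold `t`, with precision `ε`, external
validity function `exVal` and furthest pairs selected by `furthest`. -/
noncomputable def protocol (m n t : ℕ) (ε : ℝ) (exVal : EuclideanSpace ℝ (Fin m) → Bool)
    (furthest : Multiset (EuclideanSpace ℝ (Fin m)) →
      EuclideanSpace ℝ (Fin m) × EuclideanSpace ℝ (Fin m)) :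
    BroadcastProtocol n (EuclideanSpace ℝ (Fin m)) (EuclideanSpace ℝ (Fin m))
      (Msg m) Tag (State m n) (Action m n) where
  tag := Msg.tag
  start := State.initial n
  recv := receive t exVal
  enabled := fun a σ => Enabled t furthest σ a
  step := perform t ε furthest
  output := fun σ =>
    match σ.phase with
    | .done => some (σ.v σ.r)
    | _ => none

end ApproxAgreement

/-! Agreement rests on quorum intersection and contraction. Since `2 * (n - t) > n`, the reports
attached to two accepted votes of the same round have a common sender. Even if that sender is
faulty, its channel shows the same report to all nonfaulty nodes, so both votes were computed from
multisets that contain a common `B` with at least `n - t` elements (`exists_mem_reps`). Outside `B`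
each multiset has at most `t` points, so averaging at least halves the spread (`dist_vote_vote_le`).
In round 1 the comparison is with the multiset `S` from which some nonfaulty node computed its
estimate: elimination leaves only points within `diam S` of a point of `S` (`exists_dist_elim_le`),
so accepted votes of round 1 are at most `3 * diam S` apart, and those of round `s + 1` at most `3 *
diam S / 2 ^ s` (`dist_votes_le`).

A node stops in round `r` only if more than `t` of the estimates it holds are at most `r`. One of
these comes from a nonfaulty node, so the spread in round `r` is at most `ε`. Later votes are
averages of accepted votes and stay in the convex hull of round `r`; hence outputs of different
rounds are also close. Round 1 lies in the hull of values that passed `exVal`, which gives validity.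

For termination, acceptance tests are monotone in the local variables, so a node that never stops
eventually incorporates whatever another nonfaulty node has incorporated, up to the rounds it
reaches (`eventually_vals_le_and_reps_le`). No nonfaulty node is stuck before the least round in
which a nonfaulty node terminates, because everyone has broadcast what the earlier rounds need. On
reaching that round, a node that never stops would also hold the estimates of the terminated node;
additional estimates can only lower the `t + 1`-st smallest one, so it would have to stop. If nobody
terminates, the rounds grow beyond every finite `halt`.

The link between local states and the network is `Collects.eq_map`: each local multiset is the image
of a set of senders under a map that is the same for all nonfaulty nodes. -/

namespace ApproxAgreement

/-! ### Averages and elimination of furthest pairs. -/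

section Geometry

variable {m : ℕ}

theorem norm_sum_sub_smul_le {E : Type*} [NormedAddCommGroup E] [NormedSpace ℝ E]
    (C : Multiset E) (p : E) (D : ℝ) (h : ∀ x ∈ C, dist x p ≤ D) :
    ‖C.sum - (C.card : ℝ) • p‖ ≤ C.card * D := by
  induction C using Multiset.induction with
  | empty => simp
  | cons a C ih =>
    have h1 := ih fun x hx => h x (Multiset.mem_cons_of_mem hx)
    have h2 := h a (Multiset.mem_cons_self a C)
    rw [dist_eq_norm] at h2
    have : (a ::ₘ C).sum - ((a ::ₘ C).card : ℝ) • p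
        = (a - p) + (C.sum - (C.card : ℝ) • p) := by
      simp only [Multiset.sum_cons, Multiset.card_cons, Nat.cast_add, Nat.cast_one]
      module
    rw [this, Multiset.card_cons]
    push_cast
    linarith [norm_add_le (a - p) (C.sum - (C.card : ℝ) • p)]

theorem card_smul_vote (A : Multiset (EuclideanSpace ℝ (Fin m))) (hA : 0 < A.card) :
    (A.card : ℝ) • vote A = A.sum := by
  rw [vote, smul_smul, mul_inv_cancel₀ (by positivity), one_smul]

theorem dist_vote_right_le (A : Multiset (EuclideanSpace ℝ (Fin m))) (hA : 0 < A.card)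
    (x : EuclideanSpace ℝ (Fin m)) (D : ℝ) (h : ∀ a ∈ A, dist x a ≤ D) : dist x (vote A) ≤ D := by
  have h1 := norm_sum_sub_smul_le A x D fun a ha => by rw [dist_comm]; exact h a ha
  rw [← card_smul_vote A hA, ← smul_sub, norm_smul, Real.norm_of_nonneg (by positivity),
    ← dist_eq_norm, dist_comm] at h1
  exact le_of_mul_le_mul_left h1 (by exact_mod_cast hA)

theorem vote_mem_convexHull (A : Multiset (EuclideanSpace ℝ (Fin m))) (hA : 0 < A.card) :
    vote A ∈ convexHull ℝ {a | a ∈ A} := by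
  classical
  have key : ∀ B : Multiset (EuclideanSpace ℝ (Fin m)), B ≠ 0 → (∀ b ∈ B, b ∈ A) →
      (B.card : ℝ)⁻¹ • B.sum ∈ convexHull ℝ {a | a ∈ A} := by
    intro B
    induction B using Multiset.induction with
    | empty => intro h; exact absurd rfl h
    | cons b B ih =>
      intro _ hB
      have hb : b ∈ convexHull ℝ {a | a ∈ A} :=
        subset_convexHull ℝ _ (hB b (Multiset.mem_cons_self b B))
      by_cases h0 : B = 0
      · subst h0
        simpa using hb
      · have h1 := ih h0 fun c hc => hB c (Multiset.mem_cons_of_mem hc)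
        have hpos : (0 : ℝ) < B.card := by exact_mod_cast Multiset.card_pos.2 h0
        have h2 := (convex_convexHull ℝ {a | a ∈ A}) hb h1
          (a := 1 / (B.card + 1)) (b := B.card / (B.card + 1)) (by positivity) (by positivity)
          (by field_simp; ring)
        convert h2 using 1
        rw [Multiset.sum_cons, Multiset.card_cons, smul_add, smul_smul]
        push_cast
        congr 2
        · rw [one_div]
        · field_simp
  exact key A (Multiset.card_pos.1 hA) fun _ h => h

/-- Two multisets of at most `n` points with a common part of size `n - t` have averages that
are at most half as far apart as the points. -/
theorem dist_vote_vote_le {n t : ℕ} (hnt : 3 * t + 1 ≤ n)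
    {A A' B : Multiset (EuclideanSpace ℝ (Fin m))} {D : ℝ} (hB : n - t ≤ B.card) (hBA : B ≤ A)
    (hBA' : B ≤ A') (hA : A.card ≤ n) (hA' : A'.card ≤ n)
    (h : ∀ a ∈ A, ∀ a' ∈ A', dist a a' ≤ D) : dist (vote A) (vote A') ≤ D / 2 := by
  wlog hle : A'.card ≤ A.card generalizing A A'
  · rw [dist_comm]
    exact this hBA' hBA hA' hA (fun a ha a' ha' => by rw [dist_comm]; exact h a' ha' a ha)
      (by omega)
  obtain ⟨C, rfl⟩ := Multiset.le_iff_exists_add.1 hBA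
  obtain ⟨C', rfl⟩ := Multiset.le_iff_exists_add.1 hBA'
  have hBpos : 0 < B.card := by omega
  obtain ⟨b, hb⟩ := Multiset.card_pos_iff_exists_mem.1 hBpos
  have hD : 0 ≤ D := by
    simpa using h b (Multiset.mem_add.2 (.inl hb)) b (Multiset.mem_add.2 (.inl hb))
  simp only [Multiset.card_add] at hle hA hA'
  have hy : ∀ x ∈ B + C, dist x (vote (B + C')) ≤ D := fun x hx =>
    dist_vote_right_le _ (by rw [Multiset.card_add]; omega) x D fun a ha => h x hx a ha
  set y := vote (B + C') with hydef
  have hA2 : ((B + C).card : ℝ) • vote (B + C) = B.sum + C.sum := by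
    rw [card_smul_vote _ (by rw [Multiset.card_add]; omega), Multiset.sum_add]
  have hA2' : ((B + C').card : ℝ) • y = B.sum + C'.sum := by
    rw [hydef, card_smul_vote _ (by rw [Multiset.card_add]; omega), Multiset.sum_add]
  simp only [Multiset.card_add, Nat.cast_add] at hA2 hA2'
  have hcc : (C'.card : ℝ) ≤ C.card := by exact_mod_cast (by omega : C'.card ≤ C.card)
  -- The smaller multiset is padded with `C.card - C'.card` copies of its own average `y`, which
  -- does not move the average. Now `C` faces a multiset of equal size, and every point of `C` is
  -- within `D` of the barycentre of that padded part.
  have hmain : ‖C.sum - (C'.sum + ((C.card : ℝ) - C'.card) • y)‖ ≤ C.card * D := by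
    rcases Nat.eq_zero_or_pos C.card with h0 | h0
    · have h0' : C'.card = 0 := by omega
      rw [h0, h0', Multiset.card_eq_zero.1 h0, Multiset.card_eq_zero.1 h0']
      simp
    · have hpos : (0 : ℝ) < C.card := by exact_mod_cast h0
      have h1 := norm_sum_sub_smul_le C
        ((C.card : ℝ)⁻¹ • (C'.sum + ((C.card : ℝ) - C'.card) • y)) D fun x hx => by
          have hx' : x ∈ B + C := Multiset.mem_add.2 (.inr hx)
          have e1 := norm_sum_sub_smul_le C' x D fun a ha => by
            rw [dist_comm]; exact h x hx' a (Multiset.mem_add.2 (.inr ha))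
          have e2 := hy x hx'
          rw [dist_comm, dist_eq_norm] at e2
          have e3 : ‖((C.card : ℝ) - C'.card) • (y - x)‖ ≤ (C.card - C'.card) * D := by
            rw [norm_smul, Real.norm_of_nonneg (by linarith)]
            exact mul_le_mul_of_nonneg_left e2 (by linarith)
          have e4 := norm_add_le (C'.sum - (C'.card : ℝ) • x) (((C.card : ℝ) - C'.card) • (y - x))
          rw [dist_comm, dist_eq_norm]
          refine le_of_mul_le_mul_left (a := (C.card : ℝ)) ?_ hpos
          rw [← Real.norm_of_nonneg hpos.le, ← norm_smul, Real.norm_of_nonneg hpos.le, smul_sub,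
            smul_smul, mul_inv_cancel₀ hpos.ne', one_smul]
          have e5 : C'.sum + ((C.card : ℝ) - C'.card) • y - (C.card : ℝ) • x
              = (C'.sum - (C'.card : ℝ) • x) + ((C.card : ℝ) - C'.card) • (y - x) := by module
          rw [e5]
          linarith
      rwa [smul_smul, mul_inv_cancel₀ hpos.ne', one_smul] at h1
  have hdist : ((B.card : ℝ) + C.card) * dist (vote (B + C)) y ≤ C.card * D := by
    have h0 : (0 : ℝ) ≤ (B.card : ℝ) + C.card := by positivity
    rw [dist_eq_norm, ← Real.norm_of_nonneg h0, ← norm_smul, smul_sub, hA2]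
    have e : B.sum + C.sum - ((B.card : ℝ) + C.card) • y
        = C.sum - (C'.sum + ((C.card : ℝ) - C'.card) • y) := by
      have : C'.sum = ((B.card : ℝ) + C'.card) • y - B.sum := by rw [hA2']; abel
      rw [this]
      module
    rwa [e]
  -- `C.card ≤ t`, whereas `B.card ≥ n - t ≥ 2 * t + 1`; this is the source of the factor one half.
  have hc2 : 2 * (C.card : ℝ) ≤ B.card + C.card := by
    exact_mod_cast (by omega : 2 * C.card ≤ B.card + C.card)
  have hbc : (0 : ℝ) < (B.card : ℝ) + C.card := by
    exact_mod_cast (by omega : 0 < B.card + C.card)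
  refine le_of_mul_le_mul_left (hdist.trans ?_) hbc
  nlinarith

variable {furthest : Multiset (EuclideanSpace ℝ (Fin m)) →
      EuclideanSpace ℝ (Fin m) × EuclideanSpace ℝ (Fin m)}

theorem elim_zero (A : Multiset (EuclideanSpace ℝ (Fin m))) : elim furthest 0 A = A := rfl

open Classical in
theorem elim_succ (t : ℕ) (A : Multiset (EuclideanSpace ℝ (Fin m))) :
    elim furthest (t + 1) A = elim furthest t (A - {(furthest A).1, (furthest A).2}) := by
  unfold elim
  rw [Function.iterate_succ_apply]

theorem elim_le (t : ℕ) (A : Multiset (EuclideanSpace ℝ (Fin m))) : elim furthest t A ≤ A := by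
  classical
  induction t generalizing A with
  | zero => exact le_rfl
  | succ t ih =>
    rw [elim_succ]
    exact (ih _).trans (Multiset.sub_le_self _ _)

/-- Truncated subtraction removes at most two elements per round whatever `furthest` selects, so
`IsFurthest` plays no role here. -/
theorem card_le_card_elim (t : ℕ) (A : Multiset (EuclideanSpace ℝ (Fin m))) :
    A.card ≤ (elim furthest t A).card + 2 * t := by
  classical
  induction t generalizing A with
  | zero => simp [elim_zero]
  | succ t ih =>
    rw [elim_succ]
    have h1 := ih (A - {(furthest A).1, (furthest A).2})
    have h2 := Multiset.card_le_card
      (le_tsub_add : A ≤ A - {(furthest A).1, (furthest A).2} + {(furthest A).1, (furthest A).2})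
    rw [Multiset.card_add, Multiset.card_pair] at h2
    omega

/-- If all but `t` elements of `A` belong to `B`, then the elimination of `t` furthest pairs
leaves only points that are close to `B`. -/
theorem exists_dist_elim_le (hf : IsFurthest furthest) {d : ℝ} (t : ℕ)
    {A B : Multiset (EuclideanSpace ℝ (Fin m))} (hBA : B ≤ A) (hA : A.card ≤ B.card + t)
    (hB : 2 * t + 1 ≤ B.card) (h : ∀ a ∈ B, ∀ b ∈ B, dist a b ≤ d) :
    ∃ b ∈ B, ∀ a ∈ elim furthest t A, dist a b ≤ d := by
  classical
  induction t generalizing A B with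
  | zero =>
    obtain ⟨b, hb⟩ := Multiset.card_pos_iff_exists_mem.1 (by omega : 0 < B.card)
    obtain rfl := Multiset.eq_of_le_of_card_le hBA (by omega)
    exact ⟨b, hb, fun a ha => h a ha b hb⟩
  | succ t ih =>
    have hcard := Multiset.card_le_card hBA
    obtain ⟨hle, hmax⟩ := hf A (by omega)
    by_cases hd : dist (furthest A).1 (furthest A).2 ≤ d
    -- All of `A` already has diameter at most `d`, so any element of `B` serves as centre.
    · obtain ⟨b, hb⟩ := Multiset.card_pos_iff_exists_mem.1 (by omega : 0 < B.card)
      refine ⟨b, hb, fun a ha => (hmax a (Multiset.mem_of_le (elim_le _ _) ha) b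
        (Multiset.mem_of_le hBA hb)).trans hd⟩
    · rw [elim_succ]
      set p := (furthest A).1
      set q := (furthest A).2
      -- A pair further apart than `d` cannot lie inside `B`. Its removal costs `A` two elements and
      -- `B` at most one, so both cardinality hypotheses hold again with `t` in place of `t + 1`.
      have h1 : (B ∩ {p, q}).card ≤ 1 := by
        by_contra! hc
        have h2 : B ∩ {p, q} = {p, q} :=
          Multiset.eq_of_le_of_card_le Multiset.inter_le_right (by rw [Multiset.card_pair]; omega)
        have h3 : {p, q} ≤ B := h2 ▸ Multiset.inter_le_left
        exact hd (h p (Multiset.mem_of_le h3 (by simp)) q (Multiset.mem_of_le h3 (by simp)))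
      have h2 : (B - {p, q}).card + (B ∩ {p, q}).card = B.card := by
        rw [← Multiset.card_add, Multiset.sub_add_inter]
      have h3 : (A - {p, q}).card = A.card - 2 := by
        rw [Multiset.card_sub hle, Multiset.card_pair]
      obtain ⟨b, hb, hb'⟩ := ih (A := A - {p, q}) (B := B - {p, q}) (tsub_le_tsub_right hBA _)
        (by omega) (by omega) fun a ha b hb => h a (Multiset.mem_of_le (Multiset.sub_le_self _ _) ha)
          b (Multiset.mem_of_le (Multiset.sub_le_self _ _) hb)
      exact ⟨b, Multiset.mem_of_le (Multiset.sub_le_self _ _) hb, hb'⟩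

theorem dist_le_diam {A : Multiset (EuclideanSpace ℝ (Fin m))} {a b : EuclideanSpace ℝ (Fin m)}
    (ha : a ∈ A) (hb : b ∈ A) : dist a b ≤ diam A := by
  classical
  refine Metric.dist_le_diam_of_mem ?_ ha hb
  have : {x | x ∈ A} = (A.toFinset : Set (EuclideanSpace ℝ (Fin m))) := by ext; simp
  rw [this]
  exact A.toFinset.finite_toSet.isBounded

theorem diam_nonneg (A : Multiset (EuclideanSpace ℝ (Fin m))) : 0 ≤ diam A := Metric.diam_nonneg

theorem three_mul_diam_div_le {ε : ℝ} (hε : 0 < ε) {A : Multiset (EuclideanSpace ℝ (Fin m))} {s : ℕ}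
    (h : enoughRounds ε A ≤ ((s + 1 : ℕ) : ℤ)) : 3 * diam A / 2 ^ s ≤ ε := by
  -- Diameter zero is treated apart because comparing logarithms requires a positive argument. With
  -- the convention `Real.logb 2 0 = 0`, the estimate is then the value 1 prescribed by the
  -- protocol.
  rcases (diam_nonneg A).eq_or_lt with h0 | h0
  · rw [← h0]
    simpa using hε.le
  · have h1 : ⌈Real.logb 2 (3 * diam A / ε)⌉ ≤ (s : ℤ) := by
      unfold enoughRounds at h
      push_cast at h
      linarith
    have h2 := (Real.logb_le_iff_le_rpow (by norm_num) (by positivity)).1 (Int.ceil_le.1 h1)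
    have h3 : 3 * diam A / ε ≤ 2 ^ s := by exact_mod_cast h2
    rw [div_le_iff₀ (by positivity)] at h3 ⊢
    linarith

theorem dist_le_of_mem_convexHull {E : Type*} [NormedAddCommGroup E] [NormedSpace ℝ E]
    {S : Set E} {x y : E} {D : ℝ} (hy : y ∈ convexHull ℝ S) (h : ∀ a ∈ S, dist a x ≤ D) :
    dist y x ≤ D :=
  convexHull_min (t := Metric.closedBall x D) (fun a ha => h a ha) (convex_closedBall x D) hy

/-- Two points that are left over by the elimination from two sets which both contain most of a
set of diameter `d` have distance at most `3 * d`. -/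
theorem dist_le_of_mem_convexHull_elim (hf : IsFurthest furthest) {t : ℕ} {d : ℝ}
    {S A B A' B' : Multiset (EuclideanSpace ℝ (Fin m))} {v v' : EuclideanSpace ℝ (Fin m)}
    (hd : ∀ a ∈ S, ∀ b ∈ S, dist a b ≤ d)
    (hBS : B ≤ S) (hBA : B ≤ A) (hA : A.card ≤ B.card + t) (hB : 2 * t + 1 ≤ B.card)
    (hBS' : B' ≤ S) (hBA' : B' ≤ A') (hA' : A'.card ≤ B'.card + t) (hB' : 2 * t + 1 ≤ B'.card)
    (hv : v ∈ convexHull ℝ {a | a ∈ elim furthest t A})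
    (hv' : v' ∈ convexHull ℝ {a | a ∈ elim furthest t A'}) : dist v v' ≤ 3 * d := by
  have hS {C : Multiset (EuclideanSpace ℝ (Fin m))} (hC : C ≤ S) :
      ∀ a ∈ C, ∀ b ∈ C, dist a b ≤ d := fun a ha b hb =>
    hd a (Multiset.mem_of_le hC ha) b (Multiset.mem_of_le hC hb)
  obtain ⟨b, hb, h⟩ := exists_dist_elim_le hf t hBA hA hB (hS hBS)
  obtain ⟨b', hb', h'⟩ := exists_dist_elim_le hf t hBA' hA' hB' (hS hBS')
  have e1 := dist_le_of_mem_convexHull hv h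
  have e2 := dist_le_of_mem_convexHull hv' h'
  have e3 := hd b (Multiset.mem_of_le hBS hb) b' (Multiset.mem_of_le hBS' hb')
  have e4 := dist_triangle4 v b b' v'
  rw [dist_comm v' b'] at e2
  linarith

end Geometry

/-! ### The `t + 1`-st smallest element as a counting condition. -/

/-- The entry number `t` of the sorted list is at most `x` if and only if more than `t` entries
are at most `x`. -/
theorem sort_getD_le_iff (T : Multiset ℤ) {t : ℕ} (ht : t < T.card) (x : ℤ) :
    (T.sort (· ≤ ·)).getD t 0 ≤ x ↔ t < (T.filter (· ≤ x)).card := by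
  set l := T.sort (· ≤ ·) with hl
  have hlen : l.length = T.card := Multiset.length_sort _
  have hsorted : l.Pairwise (· ≤ ·) := Multiset.pairwise_sort _ _
  have hT : (T.filter (· ≤ x)).card = l.countP (· ≤ x) := by
    conv_lhs => rw [← Multiset.sort_eq T (· ≤ ·)]
    rw [← Multiset.countP_eq_card_filter, Multiset.coe_countP]
  rw [hT]
  clear_value l
  rw [← hlen] at ht
  clear hlen hl hT
  induction l generalizing t with
  | nil => simp at ht
  | cons a l ih =>
    rw [List.pairwise_cons] at hsorted
    cases t with
    | zero =>
      simp only [List.getD_cons_zero, List.countP_pos_iff, List.mem_cons, decide_eq_true_eq]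
      constructor
      · intro h
        exact ⟨a, .inl rfl, h⟩
      · rintro ⟨b, rfl | hb, hbx⟩
        · exact hbx
        · exact (hsorted.1 b hb).trans hbx
    | succ t =>
      have ht' : t < l.length := by simpa using ht
      rw [List.getD_cons_succ]
      refine (ih ht' hsorted.2).trans ?_
      rw [List.countP_cons]
      by_cases ha : a ≤ x
      · simp [ha]
      · have h0 : l.countP (· ≤ x) = 0 := by
          rw [List.countP_eq_zero]
          intro b hb
          simp only [decide_eq_true_eq]
          have := hsorted.1 b hb
          omega
        simp [ha, h0]

/-! ### Local transitions of one node. -/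

/-- `Step t ε exVal furthest σ σ' out got`: a node goes from the local state `σ` to the local state
`σ'`, sends the broadcasts `out`, and, if `got = some (j, M)`, the broadcast `M` of node `j` is
incorporated into the local variables of the node. -/
inductive Step {m n : ℕ} (t : ℕ) (ε : ℝ) (exVal : EuclideanSpace ℝ (Fin m) → Bool)
    (furthest : Multiset (EuclideanSpace ℝ (Fin m)) →
      EuclideanSpace ℝ (Fin m) × EuclideanSpace ℝ (Fin m)) (σ : State m n) :
    State m n → List (Msg m) → Option (Fin n × Msg m) → Prop
  | idle : Step t ε exVal furthest σ σ [] none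
  | store (W : Set (Fin n × Msg m)) : Step t ε exVal furthest σ { σ with waiting := W } [] none
  | initValue (j : Fin n) (v : EuclideanSpace ℝ (Fin m)) (h : σ.phase ≠ .done)
      (hv : exVal v = true) :
      Step t ε exVal furthest σ { σ with vals := Function.update σ.vals 0 (v ::ₘ σ.vals 0) }
        (if (v ::ₘ σ.vals 0).card = n - t then [.report (v ::ₘ σ.vals 0) 0] else [])
        (some (j, .initValue v))
  | enough (j : Fin n) (e : ℤ) (h : σ.phase ≠ .done) :
      Step t ε exVal furthest σ { σ with
          terminationTimes := e ::ₘ σ.terminationTimes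
          halt := if n - t ≤ (e ::ₘ σ.terminationTimes).card then
            ((((e ::ₘ σ.terminationTimes).sort (· ≤ ·)).getD t 0 : ℤ) : WithTop ℤ)
            else σ.halt } [] (some (j, .enough e))
  | begin (h : σ.phase = .start) :
      Step t ε exVal furthest σ { σ with phase := .init } [.initValue (σ.v 0)] none
  | acceptValue (W : Set (Fin n × Msg m)) (j : Fin n) (v : EuclideanSpace ℝ (Fin m))
      (A : Multiset (EuclideanSpace ℝ (Fin m)))
      (R : Multiset (Multiset (EuclideanSpace ℝ (Fin m)))) (s : ℕ) (h : σ.phase = .main)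
      (hM : ValueMessageReady t furthest σ v A R s) :
      Step t ε exVal furthest σ
        { σ with waiting := W, vals := Function.update σ.vals s (v ::ₘ σ.vals s) }
        (if s = σ.r ∧ (v ::ₘ σ.vals s).card = n - t then [.report (v ::ₘ σ.vals s) s] else [])
        (some (j, .value v A R s))
  | acceptReport (W : Set (Fin n × Msg m)) (j : Fin n)
      (A : Multiset (EuclideanSpace ℝ (Fin m))) (s : ℕ)
      (h : σ.phase = .init ∧ s = 0 ∧ (A ::ₘ σ.reps s).card ≠ n - t ∨
        σ.phase = .main ∧ ¬(s = σ.r ∧ (A ::ₘ σ.reps s).card = n - t))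
      (hM : ReportMessageReady t σ A s) :
      Step t ε exVal furthest σ
        { σ with waiting := W, reps := Function.update σ.reps s (A ::ₘ σ.reps s) } []
        (some (j, .report A s))
  | lastInitReport (W : Set (Fin n × Msg m)) (j : Fin n)
      (A : Multiset (EuclideanSpace ℝ (Fin m)))
      (h : σ.phase = .init) (hR : (A ::ₘ σ.reps 0).card = n - t)
      (hM : ReportMessageReady t σ A 0) :
      Step t ε exVal furthest σ
        { σ with
          waiting := W
          reps := Function.update σ.reps 0 (A ::ₘ σ.reps 0)
          v := Function.update σ.v 1 (vote (elim furthest t (σ.vals 0)))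
          initVals := σ.vals 0
          initReps := A ::ₘ σ.reps 0 } [.enough (enoughRounds ε (σ.vals 0))]
        (some (j, .report A 0))
  | lastMainReport (W : Set (Fin n × Msg m)) (j : Fin n)
      (A : Multiset (EuclideanSpace ℝ (Fin m)))
      (h : σ.phase = .main) (hR : (A ::ₘ σ.reps σ.r).card = n - t)
      (hM : ReportMessageReady t σ A σ.r) :
      Step t ε exVal furthest σ
        { σ with
          waiting := W
          reps := Function.update σ.reps σ.r (A ::ₘ σ.reps σ.r)
          r := σ.r + 1
          v := Function.update σ.v (σ.r + 1) (vote (σ.vals σ.r)) }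
        [.value (vote (σ.vals σ.r)) (σ.vals σ.r) (A ::ₘ σ.reps σ.r) (σ.r + 1)]
        (some (j, .report A σ.r))
  | enterMain (h : σ.phase = .init) (hT : n - t ≤ σ.terminationTimes.card)
      (hR : n - t ≤ (σ.reps 0).card) :
      Step t ε exVal furthest σ { σ with phase := .main, r := 1 }
        [.value (σ.v 1) σ.initVals σ.initReps 1] none
  | terminate (h : σ.phase = .main) (hr : σ.halt ≤ ((σ.r : ℤ) : WithTop ℤ)) :
      Step t ε exVal furthest σ { σ with phase := .done } [] none

/-- The broadcasts that are incorporated into the local variables when they are received. -/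
def Msg.IsImmediate {m : ℕ} (exVal : EuclideanSpace ℝ (Fin m) → Bool) : Msg m → Prop
  | .initValue v => exVal v = true
  | .enough _ => True
  | _ => False

/-- The broadcasts that are stored when they are received. -/
def Msg.IsStored {m : ℕ} : Msg m → Prop
  | .value _ _ _ _ => True
  | .report _ _ => True
  | _ => False

section

variable {m n t : ℕ} {ε : ℝ} {exVal : EuclideanSpace ℝ (Fin m) → Bool}
  {furthest : Multiset (EuclideanSpace ℝ (Fin m)) →
      EuclideanSpace ℝ (Fin m) × EuclideanSpace ℝ (Fin m)} {σ σ' : State m n}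
  {out : List (Msg m)} {got : Option (Fin n × Msg m)}

open Classical in
theorem step_receive (j : Fin n) (M : Msg m) (σ : State m n) :
    Step t ε exVal furthest σ (receive t exVal j M σ).1 (receive t exVal j M σ).2
      (if σ.phase ≠ .done ∧ M.IsImmediate exVal then some (j, M) else none) := by
  by_cases hd : σ.phase = .done
  · have h1 : receive t exVal j M σ = (σ, []) := by
      unfold receive; rw [hd]
    rw [h1, if_neg (by simp [hd])]
    exact .idle
  · cases M with
    | initValue v =>
      by_cases hv : exVal v = true
      · have h1 : receive t exVal j (.initValue v) σ =
            ({ σ with vals := Function.update σ.vals 0 (v ::ₘ σ.vals 0) },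
              if (v ::ₘ σ.vals 0).card = n - t then [.report (v ::ₘ σ.vals 0) 0] else []) := by
          unfold receive
          cases h : σ.phase <;> simp_all
        rw [if_pos (show σ.phase ≠ .done ∧ (Msg.initValue v).IsImmediate exVal from ⟨hd, hv⟩), h1]
        exact .initValue j v hd hv
      · have h1 : receive t exVal j (.initValue v) σ = (σ, []) := by
          unfold receive
          cases h : σ.phase <;> simp_all
        rw [h1, if_neg (by rintro ⟨-, h⟩; exact hv h)]
        exact .idle
    | enough e =>
      rw [if_pos ⟨hd, trivial⟩]
      have := Step.enough (t := t) (ε := ε) (exVal := exVal) (furthest := furthest) j e hd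
      unfold receive
      cases h : σ.phase <;> simp_all
    | value v A R s =>
      rw [if_neg (by simp [Msg.IsImmediate])]
      have := Step.store (t := t) (ε := ε) (exVal := exVal) (furthest := furthest) (σ := σ)
        (insert (j, .value v A R s) σ.waiting)
      unfold receive
      cases h : σ.phase <;> simp_all
    | report A s =>
      rw [if_neg (by simp [Msg.IsImmediate])]
      have := Step.store (t := t) (ε := ε) (exVal := exVal) (furthest := furthest) (σ := σ)
        (insert (j, .report A s) σ.waiting)
      unfold receive
      cases h : σ.phase <;> simp_all

/-- The broadcast that is accepted in an internal step. -/
def Action.accepted {m n : ℕ} : Action m n → Option (Fin n × Msg m)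
  | .accept j M => some (j, M)
  | _ => none

theorem step_perform {a : Action m n} (ha : Enabled t furthest σ a) :
    Step t ε exVal furthest σ (perform t ε furthest a σ).1 (perform t ε furthest a σ).2
      a.accepted := by
  cases a with
  | begin => exact .begin ha
  | enterMain => exact .enterMain ha.1 ha.2.1 ha.2.2
  | terminate => exact .terminate ha.1 ha.2
  | accept j M =>
    cases M with
    | initValue v => exact ha.elim
    | enough e => exact ha.elim
    | value v A R s => exact .acceptValue _ j v A R s ha.2.1 ha.2.2
    | report A s =>
      obtain ⟨-, ⟨hp, rfl⟩ | hp, hM⟩ := ha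
      · by_cases hc : (A ::ₘ σ.reps 0).card = n - t
        · have := Step.lastInitReport (t := t) (ε := ε) (exVal := exVal) (furthest := furthest)
            (σ.waiting \ {(j, .report A 0)}) j A hp hc hM
          simpa only [perform, hp, acceptInitReport, Action.accepted, if_pos hc] using this
        · have := Step.acceptReport (t := t) (ε := ε) (exVal := exVal) (furthest := furthest)
            (σ.waiting \ {(j, .report A 0)}) j A 0 (.inl ⟨hp, rfl, hc⟩) hM
          simpa only [perform, hp, acceptInitReport, Action.accepted, if_neg hc] using this
      · by_cases hc : s = σ.r ∧ (A ::ₘ σ.reps s).card = n - t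
        · obtain ⟨rfl, hc⟩ := hc
          have := Step.lastMainReport (t := t) (ε := ε) (exVal := exVal) (furthest := furthest)
            (σ.waiting \ {(j, .report A σ.r)}) j A hp hc hM
          simpa only [perform, hp, acceptMainReport, Action.accepted, true_and, if_pos hc] using this
        · have := Step.acceptReport (t := t) (ε := ε) (exVal := exVal) (furthest := furthest)
            (σ.waiting \ {(j, .report A s)}) j A s (.inr ⟨hp, hc⟩) hM
          simpa only [perform, hp, acceptMainReport, Action.accepted, if_neg hc] using this

/-- The order of the phases. -/
def Phase.rank : Phase → ℕ
  | .start => 0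
  | .init => 1
  | .main => 2
  | .done => 3

theorem le_update_cons {α : Type*} (f : ℕ → Multiset α) (s : ℕ) (a : α) :
    f ≤ Function.update f s (a ::ₘ f s) := by
  intro u
  by_cases h : u = s
  · subst h; rw [Function.update_self]; exact Multiset.le_cons_self _ _
  · rw [Function.update_of_ne h]

theorem Step.vals_le (h : Step t ε exVal furthest σ σ' out got) : σ.vals ≤ σ'.vals := by
  cases h <;> first | exact le_rfl | exact le_update_cons _ _ _

theorem Step.reps_le (h : Step t ε exVal furthest σ σ' out got) : σ.reps ≤ σ'.reps := by
  cases h <;> first | exact le_rfl | exact le_update_cons _ _ _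

theorem Step.terminationTimes_le (h : Step t ε exVal furthest σ σ' out got) :
    σ.terminationTimes ≤ σ'.terminationTimes := by
  cases h <;> first | exact le_rfl | exact Multiset.le_cons_self _ _

theorem Step.rank_le (h : Step t ε exVal furthest σ σ' out got) :
    σ.phase.rank ≤ σ'.phase.rank := by
  cases h <;> simp_all [Phase.rank]

theorem Step.v_zero (h : Step t ε exVal furthest σ σ' out got) : σ'.v 0 = σ.v 0 := by
  cases h <;> simp [Function.update]

/-- The test bounds the contents of a message by local variables that only grow, so it stays passed
once it is passed. This keeps a waiting message continuously enabled, as fairness demands. -/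
theorem ValueMessageReady.mono {v : EuclideanSpace ℝ (Fin m)}
    {A : Multiset (EuclideanSpace ℝ (Fin m))}
    {R : Multiset (Multiset (EuclideanSpace ℝ (Fin m)))} {s : ℕ}
    (h : ValueMessageReady t furthest σ v A R s) (hr : s ≤ σ'.r)
    (hv : σ.vals (s - 1) ≤ σ'.vals (s - 1)) (hR : σ.reps (s - 1) ≤ σ'.reps (s - 1)) :
    ValueMessageReady t furthest σ' v A R s :=
  ⟨hr, h.2.1, h.2.2.1, h.2.2.2.1, h.2.2.2.2.1.trans hv, h.2.2.2.2.2.1.trans hR, h.2.2.2.2.2.2⟩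

theorem ReportMessageReady.mono {A : Multiset (EuclideanSpace ℝ (Fin m))} {s : ℕ}
    (h : ReportMessageReady t σ A s) (hr : s ≤ σ'.r) (hv : σ.vals s ≤ σ'.vals s) :
    ReportMessageReady t σ' A s :=
  ⟨hr, h.2.1, h.2.2.trans hv⟩

end

/-! ### Local invariants of a nonfaulty node. -/

/-- The invariants of the local state of a node that has sent the broadcasts in `sent`. -/
structure Inv {m n : ℕ} (t : ℕ) (ε : ℝ) (exVal : EuclideanSpace ℝ (Fin m) → Bool)
    (furthest : Multiset (EuclideanSpace ℝ (Fin m)) →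
      EuclideanSpace ℝ (Fin m) × EuclideanSpace ℝ (Fin m))
    (σ : State m n) (sent : Set (Msg m)) : Prop where
  r_eq_zero : σ.phase.rank ≤ 1 → σ.r = 0
  r_pos : 2 ≤ σ.phase.rank → 1 ≤ σ.r
  vals_eq_zero : ∀ s, σ.r < s → σ.vals s = 0
  reps_eq_zero : ∀ s, σ.r < s → σ.reps s = 0
  reps_start : σ.phase = .start → σ.reps 0 = 0
  reps_ready : ∀ s, ∀ B ∈ σ.reps s, n - t ≤ B.card ∧ B ≤ σ.vals s
  le_card_reps : ∀ s < σ.r, n - t ≤ (σ.reps s).card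
  card_reps_lt : 1 ≤ σ.r → (σ.reps σ.r).card < n - t
  report_sent : ∀ s, n - t ≤ (σ.vals s).card →
    ∃ A, .report A s ∈ sent ∧ ReportMessageReady t σ A s
  init_sent : σ.phase ≠ .start → .initValue (σ.v 0) ∈ sent
  init_ready : n - t ≤ (σ.reps 0).card →
    ValueMessageReady t furthest { σ with r := 1 } (σ.v 1) σ.initVals σ.initReps 1
  enough_sent : n - t ≤ (σ.reps 0).card → .enough (enoughRounds ε σ.initVals) ∈ sent
  enough_eq : ∀ e, .enough e ∈ sent → n - t ≤ (σ.reps 0).card ∧ e = enoughRounds ε σ.initVals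
  value_sent : ∀ s, 1 ≤ s → s ≤ σ.r → ∃ v A R, .value v A R s ∈ sent ∧
    ValueMessageReady t furthest σ v A R s ∧ (s = σ.r → v = σ.v s)
  halt_eq : σ.halt = if n - t ≤ σ.terminationTimes.card then
    (((σ.terminationTimes.sort (· ≤ ·)).getD t 0 : ℤ) : WithTop ℤ) else ⊤
  halt_le : σ.phase = .done → σ.halt ≤ ((σ.r : ℤ) : WithTop ℤ)
  exVal_vals : ∀ v ∈ σ.vals 0, exVal v = true

section

variable {m n t : ℕ} {ε : ℝ} {exVal : EuclideanSpace ℝ (Fin m) → Bool}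
  {furthest : Multiset (EuclideanSpace ℝ (Fin m)) →
      EuclideanSpace ℝ (Fin m) × EuclideanSpace ℝ (Fin m)} {σ σ' : State m n}
  {out : List (Msg m)} {got : Option (Fin n × Msg m)} {sent sent' : Set (Msg m)}

theorem Inv.le_card_vals (h : Inv t ε exVal furthest σ sent) (hn : t < n) {s : ℕ}
    (hs : n - t ≤ (σ.reps s).card) : n - t ≤ (σ.vals s).card := by
  obtain ⟨B, hB⟩ := Multiset.card_pos_iff_exists_mem.1 (by omega : 0 < (σ.reps s).card)
  have := h.reps_ready s B hB
  exact this.1.trans (Multiset.card_le_card this.2)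

/-- Entering the main loop sets `r` to 1 outright; this is an increase only because `r` was 0 during
the initialization. -/
theorem Inv.r_le (h : Inv t ε exVal furthest σ sent) (hs : Step t ε exVal furthest σ σ' out got) :
    σ.r ≤ σ'.r := by
  cases hs with
  | enterMain h1 => rw [h.r_eq_zero (by simp [h1, Phase.rank])]; exact Nat.zero_le _
  | _ => simp

theorem inv_initial (hn : t < n) (x : EuclideanSpace ℝ (Fin m)) :
    Inv t ε exVal furthest (State.initial n x) ∅ := by
  -- A quorum is never empty, so all fields conditional on a quorum hold vacuously at the start.
  have h0 : ¬ n - t ≤ 0 := by omega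
  constructor <;> simp [State.initial, Phase.rank, -nonpos_iff_eq_zero, h0]
  omega

theorem eq_or_mem_of_mem_update_cons {α : Type*} {f : ℕ → Multiset α} {s u : ℕ} {a b : α}
    (h : b ∈ Function.update f s (a ::ₘ f s) u) : u = s ∧ b = a ∨ b ∈ f u := by
  by_cases hu : u = s
  · subst hu
    rw [Function.update_self, Multiset.mem_cons] at h
    exact h.imp (fun h => ⟨rfl, h⟩) id
  · rw [Function.update_of_ne hu] at h
    exact .inr h

theorem Step.r_eq_zero (hs : Step t ε exVal furthest σ σ' out got)
    (h : σ.phase.rank ≤ 1 → σ.r = 0) : σ'.phase.rank ≤ 1 → σ'.r = 0 := by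
  cases hs <;> simp_all [Phase.rank]

theorem Step.r_pos (hs : Step t ε exVal furthest σ σ' out got)
    (h : 2 ≤ σ.phase.rank → 1 ≤ σ.r) : 2 ≤ σ'.phase.rank → 1 ≤ σ'.r := by
  cases hs <;> simp_all [Phase.rank]

theorem Step.reps_start (hs : Step t ε exVal furthest σ σ' out got)
    (h : σ.phase = .start → σ.reps 0 = 0) : σ'.phase = .start → σ'.reps 0 = 0 := by
  cases hs <;> simp_all
  intro h
  simp_all

theorem Step.init_sent (hs : Step t ε exVal furthest σ σ' out got)
    (h : σ.phase ≠ .start → .initValue (σ.v 0) ∈ sent) :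
    σ'.phase ≠ .start → Msg.initValue (σ.v 0) ∈ sent ∨ .initValue (σ.v 0) ∈ out := by
  cases hs <;> simp_all

theorem Step.halt_le (hs : Step t ε exVal furthest σ σ' out got)
    (h : σ.phase = .done → σ.halt ≤ ((σ.r : ℤ) : WithTop ℤ)) :
    σ'.phase = .done → σ'.halt ≤ ((σ'.r : ℤ) : WithTop ℤ) := by
  cases hs <;> simp_all

/-- Most fields survive because the variables and the set of sent broadcasts only grow. Each of the
others has few critical transitions: a counter reaching exactly `n - t`, or the entry into a new
round. The delicate point is that these broadcasts are triggered by equality with `n - t`, while the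
invariants speak of at least `n - t`. -/
theorem Inv.step (hnt : 3 * t + 1 ≤ n) (h : Inv t ε exVal furthest σ sent)
    (hs : Step t ε exVal furthest σ σ' out got)
    (hsent : ∀ M, M ∈ sent' ↔ M ∈ sent ∨ M ∈ out) : Inv t ε exVal furthest σ' sent' := by
  have hn : t < n := by omega
  have hvals := hs.vals_le
  have hreps := hs.reps_le
  have hr := h.r_le hs
  have hsub : ∀ M ∈ sent, M ∈ sent' := fun M hM => (hsent M).2 (.inl hM)
  have hmain_r : 1 ≤ σ.r → σ.phase.rank ≤ 1 → False := fun h1 h2 => by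
    have := h.r_eq_zero h2; omega
  have hreport : ∀ s, n - t ≤ (σ.vals s).card →
      ∃ A, .report A s ∈ sent' ∧ ReportMessageReady t σ' A s := fun s hs => by
    obtain ⟨A, h1, h2⟩ := h.report_sent s hs
    exact ⟨A, hsub _ h1, h2.mono (h2.1.trans hr) (hvals s)⟩
  have hvalue : σ'.r = σ.r → (∀ s ≤ σ.r, 1 ≤ s → σ'.v s = σ.v s) →
      ∀ s, 1 ≤ s → s ≤ σ'.r → ∃ v A R, .value v A R s ∈ sent' ∧
      ValueMessageReady t furthest σ' v A R s ∧ (s = σ'.r → v = σ'.v s) := by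
    intro e1 e2 s h1 h2
    obtain ⟨v, A, R, h3, h4, h5⟩ := h.value_sent s h1 (e1 ▸ h2)
    refine ⟨v, A, R, hsub _ h3, h4.mono h2 (hvals _) (hreps _), fun h6 => ?_⟩
    rw [e2 s (e1 ▸ h2) h1]
    exact h5 (e1 ▸ h6)
  constructor
  · exact hs.r_eq_zero h.r_eq_zero
  · exact hs.r_pos h.r_pos
  · have := h.vals_eq_zero
    cases hs with
    | initValue j v h1 hv =>
      intro s hs
      have h0 : s ≠ 0 := by simp only at hs; omega
      simp only [Function.update_of_ne h0]
      exact this s hs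
    | acceptValue W j v A R s h1 hM =>
      intro u hu
      have hM1 := hM.1
      have h0 : u ≠ s := by simp only at hu; omega
      simp only [Function.update_of_ne h0]
      exact this u hu
    | _ => intro s hs; exact this s (hr.trans_lt hs)
  · have := h.reps_eq_zero
    cases hs with
    | acceptReport W j A s h1 hM =>
      intro u hu
      have hM1 := hM.1
      have h0 : u ≠ s := by simp only at hu; omega
      simp only [Function.update_of_ne h0]
      exact this u hu
    | lastInitReport W j A h1 hR hM =>
      intro u hu
      have h0 : u ≠ 0 := by simp only at hu; omega
      simp only [Function.update_of_ne h0]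
      exact this u hu
    | lastMainReport W j A h1 hR hM =>
      intro u hu
      simp only at hu ⊢
      rw [Function.update_of_ne (by omega)]
      exact this u (by omega)
    | _ => intro s hs; exact this s (hr.trans_lt hs)
  · exact hs.reps_start h.reps_start
  · have := h.reps_ready
    have old : ∀ s, ∀ B ∈ σ.reps s, n - t ≤ B.card ∧ B ≤ σ'.vals s := fun s B hB =>
      ⟨(this s B hB).1, (this s B hB).2.trans (hvals s)⟩
    cases hs with
    | acceptReport W j A s h1 hM =>
      intro u B hB
      rcases eq_or_mem_of_mem_update_cons hB with ⟨rfl, rfl⟩ | hB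
      · exact hM.2
      · exact old u B hB
    | lastInitReport W j A h1 hR hM =>
      intro u B hB
      rcases eq_or_mem_of_mem_update_cons hB with ⟨rfl, rfl⟩ | hB
      · exact hM.2
      · exact old u B hB
    | lastMainReport W j A h1 hR hM =>
      intro u B hB
      rcases eq_or_mem_of_mem_update_cons hB with ⟨rfl, rfl⟩ | hB
      · exact hM.2
      · exact old u B hB
    | _ => exact old
  · have old : ∀ s < σ.r, n - t ≤ (σ'.reps s).card := fun s hs =>
      (h.le_card_reps s hs).trans (Multiset.card_le_card (hreps s))
    cases hs with
    | enterMain h1 hT hR =>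
      intro s hs
      obtain rfl : s = 0 := by simp only at hs; omega
      exact hR
    | lastMainReport W j A h1 hR hM =>
      intro s hs
      rcases (Nat.lt_succ_iff.1 hs).lt_or_eq with h2 | rfl
      · exact old s h2
      · simp only [Function.update_self]; omega
    | _ => exact old
  -- In the main loop a round is left as soon as its reports reach a quorum. The guard `1 ≤ r` is
  -- needed since during the initialization `reps 0` may grow past `n - t` while estimates are still
  -- awaited.
  · have := h.card_reps_lt
    cases hs with
    | enterMain h1 hT hR =>
      intro _
      have h2 := h.reps_eq_zero 1 (by rw [h.r_eq_zero (by simp [h1, Phase.rank])]; simp)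
      simp only [h2, Multiset.card_zero]
      omega
    | lastMainReport W j A h1 hR hM =>
      intro _
      have h2 := h.reps_eq_zero (σ.r + 1) (by omega)
      simp only
      rw [Function.update_of_ne (by omega), h2, Multiset.card_zero]
      omega
    | lastInitReport W j A h1 hR hM =>
      intro h2
      exact (hmain_r h2 (by simp [h1, Phase.rank])).elim
    | acceptReport W j A s h1 hM =>
      intro h2
      rcases h1 with ⟨h1, -⟩ | ⟨h1, h3⟩
      · exact (hmain_r h2 (by simp [h1, Phase.rank])).elim
      · simp only
        by_cases h4 : σ.r = s
        · subst h4
          have h5 := this h2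
          simp only [true_and, Multiset.card_cons, Function.update_self] at h3 ⊢
          omega
        · rw [Function.update_of_ne h4]
          exact this h2
    | _ => exact this
  · cases hs with
    | initValue j v h1 hv =>
      intro s hs
      by_cases h2 : n - t ≤ (σ.vals s).card
      · exact hreport s h2
      by_cases h3 : s = 0
      · subst h3
        simp only [Function.update_self] at hs
        have h4 : (v ::ₘ σ.vals 0).card = n - t := by rw [Multiset.card_cons] at hs ⊢; omega
        refine ⟨v ::ₘ σ.vals 0, (hsent _).2 (.inr (by rw [if_pos h4]; simp)), Nat.zero_le _, hs, ?_⟩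
        simp
      · simp only [Function.update_of_ne h3] at hs
        exact absurd hs h2
    | acceptValue W j v A R s h1 hM =>
      intro u hs
      by_cases h2 : n - t ≤ (σ.vals u).card
      · exact hreport u h2
      by_cases h3 : u = s
      · subst h3
        simp only [Function.update_self] at hs
        have h4 : (v ::ₘ σ.vals u).card = n - t := by rw [Multiset.card_cons] at hs ⊢; omega
        -- The report is broadcast only in the current round; this suffices, because an earlier
        -- round has a quorum of reports and hence already has a quorum of values.
        have h5 : u = σ.r := by
          by_contra h5
          exact h2 (h.le_card_vals hn (h.le_card_reps u (lt_of_le_of_ne hM.1 h5)))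
        refine ⟨v ::ₘ σ.vals u, (hsent _).2 (.inr (by rw [if_pos ⟨h5, h4⟩]; simp)), hM.1, hs, ?_⟩
        simp
      · simp only [Function.update_of_ne h3] at hs
        exact absurd hs h2
    | _ => exact hreport
  · intro h1
    rw [hs.v_zero, hsent]
    exact hs.init_sent h.init_sent h1
  -- Readiness is stated for the state with `r := 1`: the vote for round 1 is fixed while `r` is
  -- still 0 and sent only when the main loop is entered.
  · have old : n - t ≤ (σ.reps 0).card →
        ValueMessageReady t furthest { σ' with r := 1 } (σ.v 1) σ.initVals σ.initReps 1 := fun h1 =>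
      (h.init_ready h1).mono le_rfl (hvals 0) (hreps 0)
    cases hs with
    | acceptReport W j A s h1 hM =>
      intro h2
      -- A report that does not bring the count to exactly `n - t` during the initialization can
      -- only meet a quorum that existed before; in the main loop the quorum of round 0 is always
      -- there.
      refine old ?_
      simp only at h2
      by_cases h3 : s = 0
      · subst h3
        rw [Function.update_self] at h2
        rcases h1 with ⟨-, -, h1⟩ | ⟨h1, h3⟩
        · rw [Multiset.card_cons] at h1 h2
          omega
        · exact h.le_card_reps 0 (h.r_pos (by simp [h1, Phase.rank]))
      · rwa [Function.update_of_ne (Ne.symm h3)] at h2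
    | lastInitReport W j A h1 hR hM =>
      intro _
      have h2 : n - t ≤ (σ.vals 0).card := hM.2.1.trans (Multiset.card_le_card hM.2.2)
      refine ⟨le_rfl, h2, hR.ge, ?_, le_rfl, ?_, .inl ⟨rfl, ?_⟩⟩
      · intro B hB
        rcases Multiset.mem_cons.1 hB with rfl | hB
        · exact hM.2.2
        · exact (h.reps_ready 0 B hB).2
      · simp
      -- At least `n - t ≥ 2 * t + 1` values were present, so something is left after the
      -- elimination and the vote is a genuine average.
      · have h3 := card_le_card_elim (furthest := furthest) t (σ.vals 0)
        simpa using vote_mem_convexHull (elim furthest t (σ.vals 0)) (by omega)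
    | lastMainReport W j A h1 hR hM =>
      intro h2
      have h3 := h.r_pos (by simp [h1, Phase.rank])
      simp only
      rw [Function.update_of_ne (by omega)]
      exact old (h.le_card_reps 0 h3)
    | _ => exact old
  · have old : n - t ≤ (σ.reps 0).card → .enough (enoughRounds ε σ.initVals) ∈ sent' := fun h1 =>
      hsub _ (h.enough_sent h1)
    cases hs with
    | acceptReport W j A s h1 hM =>
      intro h2
      refine old ?_
      simp only at h2
      by_cases h3 : s = 0
      · subst h3
        rw [Function.update_self] at h2
        rcases h1 with ⟨-, -, h1⟩ | ⟨h1, h3⟩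
        · rw [Multiset.card_cons] at h1 h2
          omega
        · exact h.le_card_reps 0 (h.r_pos (by simp [h1, Phase.rank]))
      · rwa [Function.update_of_ne (Ne.symm h3)] at h2
    | lastInitReport W j A h1 hR hM =>
      intro _
      exact (hsent _).2 (.inr (by simp))
    | lastMainReport W j A h1 hR hM =>
      intro _
      exact old (h.le_card_reps 0 (h.r_pos (by simp [h1, Phase.rank])))
    | _ => exact old
  · intro e he
    have old : .enough e ∈ sent → n - t ≤ (σ'.reps 0).card ∧ e = enoughRounds ε σ.initVals :=
      fun h1 => ⟨(h.enough_eq e h1).1.trans (Multiset.card_le_card (hreps 0)),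
        (h.enough_eq e h1).2⟩
    rw [hsent] at he
    cases hs with
    | lastInitReport W j A h1 hR hM =>
      rcases he with he | he
      -- An estimate sent earlier would mean that the quorum was complete before this report, so the
      -- count could not be reaching `n - t` only now.
      · have h2 := (h.enough_eq e he).1
        rw [Multiset.card_cons] at hR
        omega
      · simp only [List.mem_singleton, Msg.enough.injEq] at he
        refine ⟨?_, he⟩
        simp only [Function.update_self]
        exact hR.ge
    | initValue j v h1 hv =>
      refine old (he.resolve_right ?_)
      split_ifs <;> simp
    | acceptValue W j v A R s h1 hM =>
      refine old (he.resolve_right ?_)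
      split_ifs <;> simp
    | _ => exact old (he.resolve_right (by simp))
  · cases hs with
    | enterMain h1 hT hR =>
      intro s hs1 hs2
      obtain rfl : s = 1 := le_antisymm hs2 hs1
      exact ⟨σ.v 1, σ.initVals, σ.initReps, (hsent _).2 (.inr (by simp)),
        (h.init_ready hR).mono le_rfl le_rfl le_rfl, fun _ => rfl⟩
    | lastInitReport W j A h1 hR hM =>
      refine hvalue rfl fun s hs1 hs2 => ?_
      have := h.r_eq_zero (by simp [h1, Phase.rank])
      omega
    | lastMainReport W j A h1 hR hM =>
      intro s hs1 hs2
      have h3 := h.r_pos (by simp [h1, Phase.rank])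
      rcases (Nat.le_succ_iff.1 hs2) with h2 | rfl
      -- Votes of older rounds remain sent and ready; the clause about the current vote is void for
      -- them because `r` has moved on.
      · obtain ⟨v, A, R, h3, h4, h5⟩ := h.value_sent s hs1 h2
        refine ⟨v, A, R, hsub _ h3, h4.mono hs2 (hvals _) (hreps _), fun h6 => ?_⟩
        simp only at h6
        omega
      · refine ⟨_, _, _, (hsent _).2 (.inr (List.mem_singleton.2 rfl)), ⟨le_rfl, ?_, hR.ge, ?_, le_rfl, ?_,
          .inr ⟨by omega, rfl⟩⟩, ?_⟩
        · exact hM.2.1.trans (Multiset.card_le_card hM.2.2)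
        · intro B hB
          rcases Multiset.mem_cons.1 hB with rfl | hB
          · exact hM.2.2
          · exact (h.reps_ready _ B hB).2
        · simp
        · simp
    | _ => exact hvalue rfl fun _ _ _ => rfl
  · have := h.halt_eq
    cases hs with
    | enough j e h1 =>
      simp only
      split_ifs with h2
      · rfl
      · rw [Multiset.card_cons] at h2
        rw [this, if_neg (by omega)]
    | _ => exact this
  · exact hs.halt_le h.halt_le
  · have := h.exVal_vals
    cases hs with
    | initValue j v h1 hv =>
      intro u hu
      rcases eq_or_mem_of_mem_update_cons (f := σ.vals) (s := 0) (u := 0) (a := v) hu with ⟨-, rfl⟩ | hu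
      · exact hv
      · exact this u hu
    | acceptValue W j v A R s h1 hM =>
      intro u hu
      -- The acceptance test excludes round 0, so `vals 0` receives only initial values that passed
      -- `exVal`.
      have h0 : (0 : ℕ) ≠ s := by
        rcases hM.2.2.2.2.2.2 with h | h <;> omega
      simp only [Function.update_of_ne h0] at hu
      exact this u hu
    | _ => exact this

end

/-! ### Local multisets as collections of broadcasts. -/

/-- The tag of the broadcasts that contribute to `vals s`. -/
def valTag : ℕ → Tag
  | 0 => .initValue
  | s + 1 => .value (s + 1)

/-- The point in a broadcast. -/
noncomputable def Msg.point {m : ℕ} : Msg m → EuclideanSpace ℝ (Fin m)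
  | .initValue v => v
  | .value v _ _ _ => v
  | _ => 0

/-- The multiset of points in a report. -/
noncomputable def Msg.points {m : ℕ} : Msg m → Multiset (EuclideanSpace ℝ (Fin m))
  | .report A _ => A
  | _ => 0

/-- The number in a broadcast. -/
def Msg.number {m : ℕ} : Msg m → ℤ
  | .enough e => e
  | _ => 0

section

variable {m n t : ℕ} {ε : ℝ} {exVal : EuclideanSpace ℝ (Fin m) → Bool}
  {furthest : Multiset (EuclideanSpace ℝ (Fin m)) →
      EuclideanSpace ℝ (Fin m) × EuclideanSpace ℝ (Fin m)} {σ σ' : State m n}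
  {out : List (Msg m)} {got : Option (Fin n × Msg m)}

open Classical in
/-- The local variable `f` is the multiset of the values of `g` at the incorporated broadcasts
with tag `τ`. -/
def Collects {m : ℕ} (n t : ℕ) (ε : ℝ) (exVal : EuclideanSpace ℝ (Fin m) → Bool)
    (furthest : Multiset (EuclideanSpace ℝ (Fin m)) →
      EuclideanSpace ℝ (Fin m) × EuclideanSpace ℝ (Fin m)) {α : Type*}
    (f : State m n → Multiset α) (τ : Tag) (g : Msg m → α) : Prop :=
  (∀ x, f (State.initial n x) = 0) ∧ ∀ (σ σ' : State m n) out,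
    (Step t ε exVal furthest σ σ' out none → f σ' = f σ) ∧
    ∀ j M, Step t ε exVal furthest σ σ' out (some (j, M)) →
      f σ' = if M.tag = τ then g M ::ₘ f σ else f σ

theorem update_cons_apply {α : Type*} (f : ℕ → Multiset α) (s u : ℕ) (a : α) :
    Function.update f s (a ::ₘ f s) u = if s = u then a ::ₘ f u else f u := by
  by_cases h : s = u
  · subst h; simp
  · rw [Function.update_of_ne (Ne.symm h), if_neg h]

theorem collects_vals (s : ℕ) :
    Collects n t ε exVal furthest (fun σ => σ.vals s) (valTag s) Msg.point := by
  refine ⟨fun _ => rfl, fun σ σ' out => ⟨fun h => by cases h <;> rfl, fun j M h => ?_⟩⟩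
  cases h with
  | initValue j v h1 hv =>
    cases s <;> simp [Msg.tag, valTag, Msg.point]
  | acceptValue W j v A R s h1 hM =>
    have h0 : s ≠ 0 := by rcases hM.2.2.2.2.2.2 with h | h <;> omega
    rename_i u
    cases u <;> simp [update_cons_apply, Msg.tag, valTag, Msg.point, h0]
  | _ => cases s <;> simp [Msg.tag, valTag]

theorem collects_reps (s : ℕ) :
    Collects n t ε exVal furthest (fun σ => σ.reps s) (.report s) Msg.points := by
  refine ⟨fun _ => rfl, fun σ σ' out => ⟨fun h => by cases h <;> rfl, fun j M h => ?_⟩⟩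
  cases h <;> simp [update_cons_apply, Msg.tag, Msg.points]

theorem collects_terminationTimes :
    Collects n t ε exVal furthest State.terminationTimes .enough Msg.number := by
  refine ⟨fun _ => rfl, fun σ σ' out => ⟨fun h => by cases h <;> rfl, fun j M h => ?_⟩⟩
  cases h <;> simp [Msg.tag, Msg.number]

open Classical in
theorem receive_waiting (j : Fin n) (M : Msg m) (σ : State m n) :
    (receive t exVal j M σ).1.waiting =
      if σ.phase ≠ .done ∧ M.IsStored then insert (j, M) σ.waiting else σ.waiting := by
  unfold receive
  cases h : σ.phase <;> cases M <;> simp [Msg.IsStored] <;> split_ifs <;> rfl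

theorem perform_waiting {a : Action m n} (ha : Enabled t furthest σ a) :
    (perform t ε furthest a σ).1.waiting = σ.waiting \ {p | a.accepted = some p} := by
  cases a with
  | accept j M =>
    have e : {p | (Action.accept j M).accepted = some p} = {(j, M)} := by
      ext p
      simp [Action.accepted, eq_comm]
    rw [e]
    cases M with
    | initValue v => exact ha.elim
    | enough e => exact ha.elim
    | value v A R s => rfl
    | report A s =>
      obtain ⟨-, ⟨hp, rfl⟩ | hp, hM⟩ := ha
      · simp only [perform, hp, acceptInitReport]
        split_ifs <;> rfl
      · simp only [perform, hp, acceptMainReport]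
        split_ifs <;> rfl
  | _ => simp [perform, Action.accepted]

theorem Enabled.mem_waiting {j : Fin n} {M : Msg m} (h : Enabled t furthest σ (.accept j M)) :
    (j, M) ∈ σ.waiting ∧ M.IsStored := by
  cases M with
  | initValue v => exact h.elim
  | enough e => exact h.elim
  | value v A R s => exact ⟨h.1, trivial⟩
  | report A s => exact ⟨h.1, trivial⟩

/-- At time `k`, node `i` incorporates the broadcast `M` of node `j` into its local variables. -/
def Incorporates {m n : ℕ} (exVal : EuclideanSpace ℝ (Fin m) → Bool)
    (E : History n (Msg m) (State m n) (Action m n)) (k : ℕ) (i j : Fin n) (M : Msg m) : Prop :=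
  (E.Receives k i j M ∧ (E.state k i).phase ≠ .done ∧ M.IsImmediate exVal) ∨
    E.event k = .act i (.accept j M)

open Classical in
/-- The nodes whose broadcast with tag `τ` has been incorporated by node `i` before time `k`. -/
noncomputable def senders {m n : ℕ} (exVal : EuclideanSpace ℝ (Fin m) → Bool)
    (E : History n (Msg m) (State m n) (Action m n)) (k : ℕ) (i : Fin n) (τ : Tag) :
    Finset (Fin n) :=
  Finset.univ.filter fun j => ∃ l < k, ∃ M : Msg m, M.tag = τ ∧ Incorporates exVal E l i j M

open Classical in
/-- The broadcast with tag `τ` that the nonfaulty nodes receive from node `j`. -/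
noncomputable def content {m n : ℕ} (faulty : Finset (Fin n))
    (E : History n (Msg m) (State m n) (Action m n)) (τ : Tag) (j : Fin n) : Msg m :=
  if h : ∃ M : Msg m, M.tag = τ ∧ ∃ i ∉ faulty, ∃ k, E.Receives k i j M then h.choose
  else .initValue 0

/-- The broadcasts that node `i` has sent before time `k`. -/
def sentBefore {m n : ℕ} (t : ℕ) (ε : ℝ) (exVal : EuclideanSpace ℝ (Fin m) → Bool)
    (furthest : Multiset (EuclideanSpace ℝ (Fin m)) →
      EuclideanSpace ℝ (Fin m) × EuclideanSpace ℝ (Fin m))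
    (E : History n (Msg m) (State m n) (Action m n)) (k : ℕ) (i : Fin n) : Set (Msg m) :=
  {M | ∃ l < k, (protocol m n t ε exVal furthest).Sends E l i M}

/-! ### Executions: from local transitions to sets of senders. -/

section Execution

variable {faulty : Finset (Fin n)} {x : Fin n → EuclideanSpace ℝ (Fin m)}
  {E : History n (Msg m) (State m n) (Action m n)} {i : Fin n}

/-- Reduces every event of an execution to a single local transition, with the incorporated
broadcast as its label; local invariants and bookkeeping can then be proved by induction on time. -/
theorem exists_step (hE : (protocol m n t ε exVal furthest).IsExecution faulty x E)
    (hi : i ∉ faulty) (k : ℕ) : ∃ got,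
      Step t ε exVal furthest (E.state k i) (E.state (k + 1) i)
        ((protocol m n t ε exVal furthest).react i (E.state k i) (E.event k)).2 got ∧
      ∀ j M, Incorporates exVal E k i j M ↔ got = some (j, M) := by
  classical
  rw [hE.follows k i hi]
  have ha := hE.allowed k i hi
  unfold Incorporates History.Receives
  cases h : E.event k with
  | idle => exact ⟨none, .idle, by simp⟩
  | recv i' j M =>
    by_cases hi' : i' = i
    · subst hi'
      simp only [BroadcastProtocol.react, if_true]
      refine ⟨_, step_receive j M _, fun j' M' => ?_⟩
      split_ifs with h1
      · simp only [NetEvent.recv.injEq, true_and, or_false, Option.some.injEq,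
          Prod.mk.injEq]
        constructor
        · exact fun h => h.1
        · rintro ⟨rfl, rfl⟩
          exact ⟨⟨rfl, rfl⟩, h1⟩
      · simp only [NetEvent.recv.injEq, true_and, or_false, iff_false]
        rintro ⟨⟨rfl, rfl⟩, h2⟩
        exact h1 h2
    · simp only [BroadcastProtocol.react, if_neg hi']
      exact ⟨none, .idle, by simp [hi']⟩
  | act i' a =>
    by_cases hi' : i' = i
    · subst hi'
      simp only [BroadcastProtocol.react, if_true]
      refine ⟨_, step_perform (ha a h), fun j' M' => ?_⟩
      cases a <;> simp [Action.accepted]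
    · simp only [BroadcastProtocol.react, if_neg hi']
      exact ⟨none, .idle, by simp [hi']⟩

theorem inv_state (hnt : 3 * t + 1 ≤ n)
    (hE : (protocol m n t ε exVal furthest).IsExecution faulty x E) (hi : i ∉ faulty) (k : ℕ) :
    Inv t ε exVal furthest (E.state k i) (sentBefore t ε exVal furthest E k i) := by
  induction k with
  | zero =>
    rw [hE.starts i hi]
    have : sentBefore t ε exVal furthest E 0 i = ∅ := by simp [sentBefore]
    rw [this]
    exact inv_initial (by omega) _
  | succ k ih =>
    obtain ⟨got, hs, -⟩ := exists_step hE hi k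
    refine ih.step hnt hs fun M => ?_
    simp only [sentBefore, Set.mem_ofPred_eq, Nat.lt_succ_iff_lt_or_eq]
    constructor
    · rintro ⟨l, hl | rfl, h⟩
      · exact .inl ⟨l, hl, h⟩
      · exact .inr h
    · rintro (⟨l, hl, h⟩ | h)
      · exact ⟨l, .inl hl, h⟩
      · exact ⟨k, .inr rfl, h⟩

theorem exists_receives_of_mem_waiting
    (hE : (protocol m n t ε exVal furthest).IsExecution faulty x E)
    (hi : i ∉ faulty) {k : ℕ} {j : Fin n} {M : Msg m} (h : (j, M) ∈ (E.state k i).waiting) :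
    ∃ l < k, E.Receives l i j M := by
  classical
  induction k with
  | zero => rw [hE.starts i hi] at h; exact h.elim
  | succ k ih =>
    have old : (j, M) ∈ (E.state k i).waiting → ∃ l < k + 1, E.Receives l i j M := fun h => by
      obtain ⟨l, hl, h⟩ := ih h
      exact ⟨l, by omega, h⟩
    have ha := hE.allowed k i hi
    rw [hE.follows k i hi] at h
    cases he : E.event k with
    | idle => rw [he] at h; exact old h
    | recv i' j' M' =>
      rw [he] at h
      by_cases hi' : i' = i
      · subst hi'
        simp only [BroadcastProtocol.react, protocol, if_true, receive_waiting] at h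
        split_ifs at h
        · rcases h with h | h
          · obtain ⟨rfl, rfl⟩ := Prod.mk.inj h
            exact ⟨k, by omega, he⟩
          · exact old h
        · exact old h
      · simp only [BroadcastProtocol.react, if_neg hi'] at h
        exact old h
    | act i' a =>
      rw [he] at h
      by_cases hi' : i' = i
      · subst hi'
        simp only [BroadcastProtocol.react, protocol, if_true] at h
        rw [perform_waiting (ha a he)] at h
        exact old h.1
      · simp only [BroadcastProtocol.react, if_neg hi'] at h
        exact old h

theorem Incorporates.exists_receives
    (hE : (protocol m n t ε exVal furthest).IsExecution faulty x E)
    (hi : i ∉ faulty) {k : ℕ} {j : Fin n} {M : Msg m} (h : Incorporates exVal E k i j M) :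
    ∃ l ≤ k, E.Receives l i j M := by
  rcases h with h | h
  · exact ⟨k, le_rfl, h.1⟩
  · obtain ⟨l, hl, h⟩ :=
      exists_receives_of_mem_waiting hE hi (hE.allowed k i hi _ h).mem_waiting.1
    exact ⟨l, hl.le, h⟩

theorem exists_lt_succ_iff (k : ℕ) (p : ℕ → Prop) :
    (∃ l < k + 1, p l) ↔ (∃ l < k, p l) ∨ p k := by
  simp only [Nat.lt_succ_iff_lt_or_eq]
  constructor
  · rintro ⟨l, hl | rfl, h⟩
    · exact .inl ⟨l, hl, h⟩
    · exact .inr h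
  · rintro (⟨l, hl, h⟩ | h)
    · exact ⟨l, .inl hl, h⟩
    · exact ⟨k, .inr rfl, h⟩

/-- A stored message leaves the waiting set only by being accepted, and by channel property `once`
it never comes back. The first fact feeds fairness, the second excludes double counting. -/
theorem mem_waiting_iff (hE : (protocol m n t ε exVal furthest).IsExecution faulty x E)
    (hi : i ∉ faulty) (k : ℕ) (j : Fin n) (M : Msg m) :
    (j, M) ∈ (E.state k i).waiting ↔ M.IsStored ∧
      (∃ l < k, E.Receives l i j M ∧ (E.state l i).phase ≠ .done) ∧
      ¬∃ l < k, E.event l = .act i (.accept j M) := by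
  classical
  induction k with
  | zero => rw [hE.starts i hi]; simp [protocol, State.initial]
  | succ k ih =>
    have ha := hE.allowed k i hi
    have hw := hE.follows k i hi
    rw [exists_lt_succ_iff, exists_lt_succ_iff]
    cases h : E.event k with
    | idle =>
      have hw' : E.state (k + 1) i = E.state k i := by rw [hw, h]; rfl
      rw [hw', ih]
      simp [History.Receives, h]
    | recv i' j' M' =>
      by_cases hi' : i' = i
      · subst hi'
        have hw' : E.state (k + 1) i' = (receive t exVal j' M' (E.state k i')).1 := by
          rw [hw, h]; simp [BroadcastProtocol.react, protocol]
        have hiff : E.Receives k i' j M ↔ j' = j ∧ M' = M := by simp [History.Receives, h]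
        rw [hw', receive_waiting, hiff]
        by_cases hjM : j' = j ∧ M' = M
        · obtain ⟨rfl, rfl⟩ := hjM
          -- Acceptance presupposes an earlier receipt, which would be a second receipt of the same
          -- broadcast.
          have h1 : ¬∃ l < k, E.event l = .act i' (.accept j' M') := by
            rintro ⟨l, hl, h2⟩
            obtain ⟨l', hl', h3⟩ :=
              exists_receives_of_mem_waiting hE hi (hE.allowed l i' hi _ h2).mem_waiting.1
            have := hE.once i' hi j' M' l' k h3 h
            omega
          have h2 : (j', M') ∉ (E.state k i').waiting := fun h4 => by
            obtain ⟨l', hl', h3⟩ := exists_receives_of_mem_waiting hE hi h4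
            have := hE.once i' hi j' M' l' k h3 h
            omega
          have h3 : ¬∃ l < k, E.Receives l i' j' M' ∧ (E.state l i').phase ≠ .done := by
            rintro ⟨l, hl, h3, -⟩
            have := hE.once i' hi j' M' l k h3 h
            omega
          split_ifs with h4
          · simp [h1, h4.1, h4.2]
          · simp only [h1, h2, h3]
            tauto
        · have h1 : (j, M) ≠ (j', M') := fun h => hjM ⟨(Prod.mk.inj h).1.symm, (Prod.mk.inj h).2.symm⟩
          have h2 : (j, M) ∈ (if (E.state k i').phase ≠ .done ∧ M'.IsStored then
              insert (j', M') (E.state k i').waiting else (E.state k i').waiting) ↔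
              (j, M) ∈ (E.state k i').waiting := by
            split_ifs <;> simp [h1]
          rw [h2, ih]
          simp [hjM]
      · have hw' : E.state (k + 1) i = E.state k i := by
          rw [hw, h]; simp [BroadcastProtocol.react, hi']
        rw [hw', ih]
        simp [History.Receives, h, hi']
    | act i' a =>
      by_cases hi' : i' = i
      · subst hi'
        have hw' : E.state (k + 1) i' = (perform t ε furthest a (E.state k i')).1 := by
          rw [hw, h]; simp [BroadcastProtocol.react, protocol]
        rw [hw', perform_waiting (ha a h)]
        have hacc : a.accepted = some (j, M) ↔ a = .accept j M := by
          cases a <;> simp [Action.accepted]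
        simp only [Set.mem_sdiff, ih, Set.mem_ofPred_eq, hacc, History.Receives, h, reduceCtorEq,
          false_and, or_false, NetEvent.act.injEq, true_and]
        rw [not_or]
        simp only [and_assoc]
      · have hw' : E.state (k + 1) i = E.state k i := by
          rw [hw, h]; simp [BroadcastProtocol.react, hi']
        rw [hw', ih]
        simp [History.Receives, h, hi']

theorem content_eq (hE : (protocol m n t ε exVal furthest).IsExecution faulty x E)
    (hi : i ∉ faulty) {k : ℕ} {j : Fin n} {M : Msg m} (h : E.Receives k i j M) :
    content faulty E M.tag j = M := by
  have hex : ∃ M' : Msg m, M'.tag = M.tag ∧ ∃ i ∉ faulty, ∃ k, E.Receives k i j M' :=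
    ⟨M, rfl, i, hi, k, h⟩
  rw [content, dif_pos hex]
  obtain ⟨h1, i', hi', k', h2⟩ := hex.choose_spec
  exact hE.uniqueness i' hi' i hi j _ _ k' k h2 h h1

theorem Incorporates.content_eq (hE : (protocol m n t ε exVal furthest).IsExecution faulty x E)
    (hi : i ∉ faulty) {k : ℕ} {j : Fin n} {M : Msg m} (h : Incorporates exVal E k i j M) :
    content faulty E M.tag j = M := by
  obtain ⟨l, -, h⟩ := h.exists_receives hE hi
  exact ApproxAgreement.content_eq hE hi h

theorem mem_senders {k : ℕ} {τ : Tag} {j : Fin n} :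
    j ∈ senders exVal E k i τ ↔
      ∃ l < k, ∃ M : Msg m, M.tag = τ ∧ Incorporates exVal E l i j M := by
  simp [senders]

theorem senders_mono (i : Fin n) (τ : Tag) {k l : ℕ} (h : k ≤ l) :
    senders exVal E k i τ ⊆ senders exVal E l i τ := by
  intro j hj
  rw [mem_senders] at hj ⊢
  obtain ⟨l', hl', h'⟩ := hj
  exact ⟨l', by omega, h'⟩

/-- No node is counted twice for one tag: uniqueness forces the two messages to coincide, and one
message is neither received twice nor accepted twice. -/
theorem Incorporates.not_mem_senders
    (hE : (protocol m n t ε exVal furthest).IsExecution faulty x E)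
    (hi : i ∉ faulty) {k : ℕ} {j : Fin n} {M : Msg m} (h : Incorporates exVal E k i j M) :
    j ∉ senders exVal E k i M.tag := by
  rw [mem_senders]
  rintro ⟨l, hl, M', hM', h'⟩
  obtain rfl : M' = M := by rw [← h.content_eq hE hi, ← h'.content_eq hE hi, hM']
  rcases h with h | h
  · obtain ⟨l', hl', h1⟩ := h'.exists_receives hE hi
    have := hE.once i hi j M' l' k h1 h.1
    omega
  · have h1 := (hE.allowed k i hi _ h).mem_waiting
    rw [mem_waiting_iff hE hi] at h1
    rcases h' with h' | h'
    · have h2 := h'.2.2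
      have h3 := h1.2
      cases M' <;> simp [Msg.IsImmediate, Msg.IsStored] at h2 h3
    · exact h1.1.2.2 ⟨l, hl, h'⟩

/-- The map `content` does not depend on the receiving node. Comparing local multisets of different
nodes thus becomes comparing sets of senders, and multiset cardinalities count distinct nodes. -/
theorem Collects.eq_map {α : Type*} {f : State m n → Multiset α} {τ : Tag} {g : Msg m → α}
    (hf : Collects n t ε exVal furthest f τ g)
    (hE : (protocol m n t ε exVal furthest).IsExecution faulty x E) (hi : i ∉ faulty) (k : ℕ) :
    f (E.state k i) = (senders exVal E k i τ).val.map fun j => g (content faulty E τ j) := by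
  classical
  induction k with
  | zero =>
    have : senders exVal E 0 i τ = ∅ := by ext; simp [mem_senders]
    rw [hE.starts i hi, this]
    exact hf.1 _
  | succ k ih =>
    have hmem (j : Fin n) : j ∈ senders exVal E (k + 1) i τ ↔ j ∈ senders exVal E k i τ ∨
        ∃ M : Msg m, M.tag = τ ∧ Incorporates exVal E k i j M := by
      rw [mem_senders, exists_lt_succ_iff, mem_senders]
    obtain ⟨got, hs, hgot⟩ := exists_step hE hi k
    have same : (∀ j (M : Msg m), M.tag = τ → ¬Incorporates exVal E k i j M) →
        senders exVal E (k + 1) i τ = senders exVal E k i τ := fun h => by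
      ext j
      rw [hmem]
      constructor
      · rintro (h1 | ⟨M, h1, h2⟩)
        · exact h1
        · exact (h j M h1 h2).elim
      · exact .inl
    cases got with
    | none =>
      rw [(hf.2 _ _ _).1 hs, ih, same fun j M _ h => by simp [hgot] at h]
    | some p =>
      obtain ⟨j, M⟩ := p
      rw [(hf.2 _ _ _).2 j M hs]
      have hjM : Incorporates exVal E k i j M := (hgot j M).2 rfl
      split_ifs with hM
      · subst hM
        have : senders exVal E (k + 1) i M.tag = insert j (senders exVal E k i M.tag) := by
          ext j'
          rw [hmem, Finset.mem_insert, or_comm]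
          refine or_congr_left ⟨?_, ?_⟩
          · rintro ⟨M', -, h⟩
            rw [hgot] at h
            simp only [Option.some.injEq, Prod.mk.injEq] at h
            exact h.1.symm
          · rintro rfl
            exact ⟨M, rfl, hjM⟩
        rw [this, Finset.insert_val_of_notMem (hjM.not_mem_senders hE hi), Multiset.map_cons, ih,
          hjM.content_eq hE hi]
      · rw [ih, same fun j' M' hM' h => ?_]
        rw [hgot] at h
        simp only [Option.some.injEq, Prod.mk.injEq] at h
        exact hM (h.2 ▸ hM')

theorem Collects.card_eq {α : Type*} {f : State m n → Multiset α} {τ : Tag} {g : Msg m → α}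
    (hf : Collects n t ε exVal furthest f τ g)
    (hE : (protocol m n t ε exVal furthest).IsExecution faulty x E) (hi : i ∉ faulty) (k : ℕ) :
    (f (E.state k i)).card = (senders exVal E k i τ).card := by
  rw [hf.eq_map hE hi, Multiset.card_map]
  rfl

end Execution

end

/-! ### Quorum intersection, contraction of the votes, correctness and validity. -/

theorem exists_le_of_le_map {α β : Type*} {f : α → β} {S : Multiset α} {R : Multiset β}
    (h : R ≤ S.map f) : ∃ Q ≤ S, R = Q.map f := by
  induction S using Quotient.inductionOn with | _ s
  induction R using Quotient.inductionOn with | _ r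
  obtain ⟨l, hl, hs⟩ : List.Subperm r (s.map f) := h
  obtain ⟨q, hq, rfl⟩ := List.sublist_map_iff.1 hs
  exact ⟨q, Multiset.coe_le.2 hq.subperm, (Multiset.coe_eq_coe.2 hl).symm⟩

section

variable {m n t : ℕ} {ε : ℝ} {exVal : EuclideanSpace ℝ (Fin m) → Bool}
  {furthest : Multiset (EuclideanSpace ℝ (Fin m)) →
      EuclideanSpace ℝ (Fin m) × EuclideanSpace ℝ (Fin m)}
  {faulty : Finset (Fin n)} {x : Fin n → EuclideanSpace ℝ (Fin m)}
  {E : History n (Msg m) (State m n) (Action m n)} {i i' : Fin n}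

/-- The votes for round `s` that pass the acceptance test of some nonfaulty node. -/
def votes {m n : ℕ} (t : ℕ) (furthest : Multiset (EuclideanSpace ℝ (Fin m)) →
      EuclideanSpace ℝ (Fin m) × EuclideanSpace ℝ (Fin m)) (faulty : Finset (Fin n))
    (E : History n (Msg m) (State m n) (Action m n)) (s : ℕ) :
    Set (EuclideanSpace ℝ (Fin m)) :=
  {v | ∃ i ∉ faulty, ∃ k A R, ValueMessageReady t furthest (E.state k i) v A R s}

theorem card_vals_le (hE : (protocol m n t ε exVal furthest).IsExecution faulty x E)
    (hi : i ∉ faulty) (k s : ℕ) : ((E.state k i).vals s).card ≤ n := by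
  rw [(collects_vals s).card_eq hE hi k]
  exact (Finset.card_le_univ _).trans_eq (Fintype.card_fin n)

/-- Two quorums of senders meet because `2 * (n - t) > n`. The common sender may be faulty:
uniqueness gives both nodes the same report, and its size was checked on acceptance. -/
theorem exists_mem_reps (hnt : 3 * t + 1 ≤ n)
    (hE : (protocol m n t ε exVal furthest).IsExecution faulty x E)
    (hi : i ∉ faulty) (hi' : i' ∉ faulty) {k k' s : ℕ}
    {R R' : Multiset (Multiset (EuclideanSpace ℝ (Fin m)))}
    (hR : R ≤ (E.state k i).reps s) (hR' : R' ≤ (E.state k' i').reps s)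
    (hc : n - t ≤ R.card) (hc' : n - t ≤ R'.card) : ∃ B ∈ R, B ∈ R' ∧ n - t ≤ B.card := by
  classical
  have hB : ∀ B ∈ R, n - t ≤ B.card := fun B hB =>
    ((inv_state hnt hE hi k).reps_ready s B (Multiset.mem_of_le hR hB)).1
  rw [(collects_reps s).eq_map hE hi k] at hR
  rw [(collects_reps s).eq_map hE hi' k'] at hR'
  obtain ⟨Q, hQ, rfl⟩ := exists_le_of_le_map hR
  obtain ⟨Q', hQ', rfl⟩ := exists_le_of_le_map hR'
  have hn := Multiset.nodup_of_le hQ (Finset.nodup _)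
  have hn' := Multiset.nodup_of_le hQ' (Finset.nodup _)
  rw [Multiset.card_map] at hc hc'
  have hint : ((⟨Q, hn⟩ : Finset (Fin n)) ∩ ⟨Q', hn'⟩).Nonempty := by
    rw [← Finset.card_pos]
    have h1 := Finset.card_union_add_card_inter (⟨Q, hn⟩ : Finset (Fin n)) ⟨Q', hn'⟩
    have h2 := Finset.card_le_univ ((⟨Q, hn⟩ : Finset (Fin n)) ∪ ⟨Q', hn'⟩)
    rw [Fintype.card_fin] at h2
    have h3 : (⟨Q, hn⟩ : Finset (Fin n)).card = Q.card := rfl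
    have h4 : (⟨Q', hn'⟩ : Finset (Fin n)).card = Q'.card := rfl
    omega
  obtain ⟨j, hj⟩ := hint
  rw [Finset.mem_inter] at hj
  have h1 := Multiset.mem_map_of_mem (fun j => (content faulty E (.report s) j).points) hj.1
  exact ⟨_, h1, Multiset.mem_map_of_mem _ hj.2, hB _ h1⟩

theorem Incorporates.valueMessageReady
    (hE : (protocol m n t ε exVal furthest).IsExecution faulty x E) (hi : i ∉ faulty)
    {k s : ℕ} {j : Fin n} {v : EuclideanSpace ℝ (Fin m)}
    {A : Multiset (EuclideanSpace ℝ (Fin m))}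
    {R : Multiset (Multiset (EuclideanSpace ℝ (Fin m)))}
    (h : Incorporates exVal E k i j (.value v A R s)) :
    ValueMessageReady t furthest (E.state k i) v A R s := by
  rcases h with h | h
  · exact h.2.2.elim
  · exact (hE.allowed k i hi _ h).2.2

theorem Incorporates.reportMessageReady
    (hE : (protocol m n t ε exVal furthest).IsExecution faulty x E) (hi : i ∉ faulty)
    {k s : ℕ} {j : Fin n} {A : Multiset (EuclideanSpace ℝ (Fin m))}
    (h : Incorporates exVal E k i j (.report A s)) :
    ReportMessageReady t (E.state k i) A s := by
  rcases h with h | h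
  · exact h.2.2.elim
  · exact (hE.allowed k i hi _ h).2.2

theorem Msg.eq_value_of_tag {M : Msg m} {s : ℕ} (h : M.tag = .value s) :
    ∃ v A R, M = .value v A R s := by
  cases M <;> simp_all [Msg.tag]

theorem Msg.eq_report_of_tag {M : Msg m} {s : ℕ} (h : M.tag = .report s) :
    ∃ A, M = .report A s := by
  cases M <;> simp_all [Msg.tag]

theorem Msg.eq_enough_of_tag {M : Msg m} (h : M.tag = .enough) : ∃ e, M = .enough e := by
  cases M <;> simp_all [Msg.tag]

theorem Msg.eq_initValue_of_tag {M : Msg m} (h : M.tag = .initValue) : ∃ v, M = .initValue v := by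
  cases M <;> simp_all [Msg.tag]

/-- Votes of faulty nodes are covered too, since nothing enters `vals (s + 1)` untested. -/
theorem mem_votes_of_mem_vals (hE : (protocol m n t ε exVal furthest).IsExecution faulty x E)
    (hi : i ∉ faulty) {k s : ℕ} {v : EuclideanSpace ℝ (Fin m)}
    (hv : v ∈ (E.state k i).vals (s + 1)) : v ∈ votes t furthest faulty E (s + 1) := by
  rw [(collects_vals (s + 1)).eq_map hE hi k, Multiset.mem_map] at hv
  obtain ⟨j, hj, rfl⟩ := hv
  obtain ⟨l, -, M, hM, h⟩ := mem_senders.1 hj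
  rw [← hM, h.content_eq hE hi]
  obtain ⟨v, A, R, rfl⟩ := Msg.eq_value_of_tag hM
  exact ⟨i, hi, l, A, R, h.valueMessageReady hE hi⟩

theorem eq_vote_of_ready {v : EuclideanSpace ℝ (Fin m)}
    {A : Multiset (EuclideanSpace ℝ (Fin m))}
    {R : Multiset (Multiset (EuclideanSpace ℝ (Fin m)))} {s : ℕ} {σ : State m n}
    (h : ValueMessageReady t furthest σ v A R (s + 2)) : v = vote A := by
  rcases h.2.2.2.2.2.2 with h | h
  · omega
  · exact h.2

theorem votes_succ_subset (hnt : 3 * t + 1 ≤ n)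
    (hE : (protocol m n t ε exVal furthest).IsExecution faulty x E) (s : ℕ) :
    votes t furthest faulty E (s + 2) ⊆ convexHull ℝ (votes t furthest faulty E (s + 1)) := by
  rintro v ⟨i, hi, k, A, R, h⟩
  rw [eq_vote_of_ready h]
  have hA := h.2.1
  refine convexHull_mono ?_ (vote_mem_convexHull A (by omega))
  exact fun a ha => mem_votes_of_mem_vals hE hi (Multiset.mem_of_le h.2.2.2.2.1 ha)

theorem votes_add_subset (hnt : 3 * t + 1 ≤ n)
    (hE : (protocol m n t ε exVal furthest).IsExecution faulty x E) (s p : ℕ) :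
    votes t furthest faulty E (s + 1 + p) ⊆ convexHull ℝ (votes t furthest faulty E (s + 1)) := by
  induction p with
  | zero => exact subset_convexHull ℝ _
  | succ p ih =>
    have h := votes_succ_subset hnt hE (s + p)
    rw [show s + p + 2 = s + 1 + (p + 1) by omega, show s + p + 1 = s + 1 + p by omega] at h
    exact h.trans (convexHull_min ih (convex_convexHull ℝ _))

theorem votes_one_subset (hnt : 3 * t + 1 ≤ n)
    (hE : (protocol m n t ε exVal furthest).IsExecution faulty x E) :
    votes t furthest faulty E 1 ⊆ convexHull ℝ {v | exVal v = true} := by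
  rintro v ⟨i, hi, k, A, R, h⟩
  rcases h.2.2.2.2.2.2 with h1 | h1
  · refine convexHull_mono (fun a ha => ?_) h1.2
    exact (inv_state hnt hE hi k).exVal_vals a
      (Multiset.mem_of_le h.2.2.2.2.1 (Multiset.mem_of_le (elim_le t A) ha))
  · omega

theorem dist_votes_succ_le (hnt : 3 * t + 1 ≤ n)
    (hE : (protocol m n t ε exVal furthest).IsExecution faulty x E) {s : ℕ} {D : ℝ}
    (hD : ∀ v ∈ votes t furthest faulty E (s + 1), ∀ v' ∈ votes t furthest faulty E (s + 1),
      dist v v' ≤ D)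
    {v v' : EuclideanSpace ℝ (Fin m)} (hv : v ∈ votes t furthest faulty E (s + 2))
    (hv' : v' ∈ votes t furthest faulty E (s + 2)) : dist v v' ≤ D / 2 := by
  obtain ⟨i, hi, k, A, R, h⟩ := hv
  obtain ⟨i', hi', k', A', R', h'⟩ := hv'
  rw [eq_vote_of_ready h, eq_vote_of_ready h']
  obtain ⟨-, hA, hR, hRA, hAi, hRi, -⟩ := h
  obtain ⟨-, hA', hR', hRA', hAi', hRi', -⟩ := h'
  obtain ⟨B, hB, hB', hcB⟩ := exists_mem_reps hnt hE hi hi' hRi hRi' hR hR'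
  refine dist_vote_vote_le hnt hcB (hRA B hB) (hRA' B hB')
    ((Multiset.card_le_card hAi).trans (card_vals_le hE hi _ _))
    ((Multiset.card_le_card hAi').trans (card_vals_le hE hi' _ _)) fun a ha a' ha' => hD _ ?_ _ ?_
  · exact mem_votes_of_mem_vals hE hi (Multiset.mem_of_le hAi ha)
  · exact mem_votes_of_mem_vals hE hi' (Multiset.mem_of_le hAi' ha')

/-- The multiset `initVals` of `j` serves as common reference: by quorum intersection each accepted
`A` shares with it a report that misses at most `t` elements of `A`. -/
theorem dist_votes_one_le (hnt : 3 * t + 1 ≤ n) (hf : IsFurthest furthest)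
    (hE : (protocol m n t ε exVal furthest).IsExecution faulty x E) {j : Fin n} (hj : j ∉ faulty)
    {l : ℕ} (hl : n - t ≤ ((E.state l j).reps 0).card)
    {v v' : EuclideanSpace ℝ (Fin m)} (hv : v ∈ votes t furthest faulty E 1)
    (hv' : v' ∈ votes t furthest faulty E 1) :
    dist v v' ≤ 3 * diam (E.state l j).initVals := by
  obtain ⟨-, -, hS, hRS, -, hSj, -⟩ := (inv_state hnt hE hj l).init_ready hl
  obtain ⟨i, hi, k, A, R, -, hA, hR, hRA, hAi, hRi, h⟩ := hv
  obtain ⟨i', hi', k', A', R', -, hA', hR', hRA', hAi', hRi', h'⟩ := hv'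
  obtain ⟨B, hB, hBS, hcB⟩ := exists_mem_reps hnt hE hi hj hRi hSj hR hS
  obtain ⟨B', hB', hBS', hcB'⟩ := exists_mem_reps hnt hE hi' hj hRi' hSj hR' hS
  have h1 := (Multiset.card_le_card hAi).trans (card_vals_le hE hi _ _)
  have h1' := (Multiset.card_le_card hAi').trans (card_vals_le hE hi' _ _)
  refine dist_le_of_mem_convexHull_elim hf (S := (E.state l j).initVals)
    (fun a ha b hb => dist_le_diam ha hb)
    (hRS B hBS) (hRA B hB) (by omega) (by omega) (hRS B' hBS') (hRA' B' hB') (by omega) (by omega)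
    (h.resolve_right (by omega)).2 (h'.resolve_right (by omega)).2

theorem dist_votes_le (hnt : 3 * t + 1 ≤ n) (hf : IsFurthest furthest)
    (hE : (protocol m n t ε exVal furthest).IsExecution faulty x E) {j : Fin n} (hj : j ∉ faulty)
    {l : ℕ} (hl : n - t ≤ ((E.state l j).reps 0).card) (s : ℕ) :
    ∀ v ∈ votes t furthest faulty E (s + 1), ∀ v' ∈ votes t furthest faulty E (s + 1),
    dist v v' ≤ 3 * diam (E.state l j).initVals / 2 ^ s := by
  induction s with
  | zero =>
    intro v hv v' hv'
    simpa using dist_votes_one_le hnt hf hE hj hl hv hv'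
  | succ s ih =>
    intro v hv v' hv'
    refine (dist_votes_succ_le hnt hE ih hv hv').trans_eq ?_
    rw [pow_succ, div_div]

/-- Extracts what both correctness and validity use: the output is an accepted vote of its round,
and some nonfaulty node considers that round number large enough. -/
theorem exists_of_outputs (hnt : 3 * t + 1 ≤ n) (hcard : faulty.card ≤ t)
    (hE : (protocol m n t ε exVal furthest).IsExecution faulty x E) (hi : i ∉ faulty)
    {y : EuclideanSpace ℝ (Fin m)} (h : (protocol m n t ε exVal furthest).Outputs E i y) :
    ∃ s, y ∈ votes t furthest faulty E (s + 1) ∧ ∃ j ∉ faulty, ∃ l,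
      n - t ≤ ((E.state l j).reps 0).card ∧
      enoughRounds ε (E.state l j).initVals ≤ ((s + 1 : ℕ) : ℤ) := by
  classical
  obtain ⟨k, hk⟩ := h
  have hI := inv_state hnt hE hi k
  have hphase : (E.state k i).phase = .done ∧ y = (E.state k i).v (E.state k i).r := by
    unfold protocol at hk
    simp only at hk
    split at hk
    · rename_i h
      exact ⟨h, (Option.some.inj hk).symm⟩
    · simp at hk
  obtain ⟨hphase, rfl⟩ := hphase
  obtain ⟨s, hs⟩ : ∃ s, (E.state k i).r = s + 1 :=
    Nat.exists_eq_succ_of_ne_zero (by have := hI.r_pos (by simp [hphase, Phase.rank]); omega)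
  refine ⟨s, ?_, ?_⟩
  · obtain ⟨v, A, R, -, h1, h2⟩ := hI.value_sent (s + 1) (by omega) hs.ge
    rw [hs, ← h2 hs.symm]
    exact ⟨i, hi, k, A, R, h1⟩
  · have h1 := hI.halt_le hphase
    rw [hI.halt_eq] at h1
    split_ifs at h1 with h2
    · rw [WithTop.coe_le_coe, sort_getD_le_iff _ (by omega), hs,
        collects_terminationTimes.eq_map hE hi, Multiset.filter_map, Multiset.card_map] at h1
      set Q := (senders exVal E k i .enough).filter
        fun j => (content faulty E .enough j).number ≤ ((s + 1 : ℕ) : ℤ) with hQ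
      -- More than `t` distinct senders gave an estimate of at most `s + 1`, so one of them is
      -- nonfaulty.
      have h3 : faulty.card < Q.card := lt_of_le_of_lt hcard h1
      obtain ⟨j, hjQ, hj⟩ := Finset.exists_mem_notMem_of_card_lt_card h3
      refine ⟨j, hj, ?_⟩
      rw [hQ, Finset.mem_filter, mem_senders] at hjQ
      obtain ⟨⟨l, hl, M, hM, hM'⟩, h4⟩ := hjQ
      rw [← hM, hM'.content_eq hE hi] at h4
      obtain ⟨e, rfl⟩ := Msg.eq_enough_of_tag hM
      obtain ⟨l', -, h5⟩ := hM'.exists_receives hE hi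
      obtain ⟨p, -, hp⟩ := hE.validity_received i hi j hj _ _ h5
      obtain ⟨h6, rfl⟩ := (inv_state hnt hE hj (p + 1)).enough_eq e ⟨p, by omega, hp⟩
      exact ⟨p + 1, h6, h4⟩
    · simp at h1

theorem dist_outputs_le (hnt : 3 * t + 1 ≤ n) (hε : 0 < ε) (hf : IsFurthest furthest)
    (hcard : faulty.card ≤ t)
    (hE : (protocol m n t ε exVal furthest).IsExecution faulty x E) (hi : i ∉ faulty)
    (hi' : i' ∉ faulty) {y z : EuclideanSpace ℝ (Fin m)}
    (hy : (protocol m n t ε exVal furthest).Outputs E i y)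
    (hz : (protocol m n t ε exVal furthest).Outputs E i' z) : dist y z ≤ ε := by
  obtain ⟨s, hys, hs⟩ := exists_of_outputs hnt hcard hE hi hy
  obtain ⟨s', hzs, hs'⟩ := exists_of_outputs hnt hcard hE hi' hz
  clear hy hz hi hi'
  wlog hle : s ≤ s' generalizing y z s s'
  · rw [dist_comm]
    exact this s' hzs hs' s hys hs (by omega)
  · obtain ⟨j, hj, l, hl, he⟩ := hs
    obtain ⟨p, rfl⟩ := Nat.exists_eq_add_of_le hle
    rw [add_right_comm] at hzs
    have hD := dist_votes_le hnt hf hE hj hl s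
    rw [dist_comm]
    -- The later output lies in the hull of the votes of the earlier round, all of which are within
    -- the bound of `y`; only the estimate for the earlier round is needed.
    exact (dist_le_of_mem_convexHull (votes_add_subset hnt hE s p hzs)
      fun a ha => hD a ha y hys).trans (three_mul_diam_div_le hε he)

theorem outputs_mem_convexHull (hnt : 3 * t + 1 ≤ n) (hcard : faulty.card ≤ t)
    (hE : (protocol m n t ε exVal furthest).IsExecution faulty x E) (hi : i ∉ faulty)
    {y : EuclideanSpace ℝ (Fin m)} (hy : (protocol m n t ε exVal furthest).Outputs E i y) :
    y ∈ convexHull ℝ {v | exVal v = true} := by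
  obtain ⟨s, hys, -⟩ := exists_of_outputs hnt hcard hE hi hy
  rw [add_comm, ← zero_add 1] at hys
  exact convexHull_min (votes_one_subset hnt hE) (convex_convexHull ℝ _)
    (votes_add_subset hnt hE 0 s hys)

end

/-! ### Termination. -/

open Filter

section

variable {m n t : ℕ} {ε : ℝ} {exVal : EuclideanSpace ℝ (Fin m) → Bool}
  {furthest : Multiset (EuclideanSpace ℝ (Fin m)) →
      EuclideanSpace ℝ (Fin m) × EuclideanSpace ℝ (Fin m)}
  {faulty : Finset (Fin n)} {x : Fin n → EuclideanSpace ℝ (Fin m)}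
  {E : History n (Msg m) (State m n) (Action m n)} {i i' j : Fin n}

theorem vals_mono (hE : (protocol m n t ε exVal furthest).IsExecution faulty x E)
    (hi : i ∉ faulty) : Monotone fun k => (E.state k i).vals :=
  monotone_nat_of_le_succ fun k => by
    obtain ⟨got, hs, -⟩ := exists_step hE hi k
    exact hs.vals_le

theorem reps_mono (hE : (protocol m n t ε exVal furthest).IsExecution faulty x E)
    (hi : i ∉ faulty) : Monotone fun k => (E.state k i).reps :=
  monotone_nat_of_le_succ fun k => by
    obtain ⟨got, hs, -⟩ := exists_step hE hi k
    exact hs.reps_le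

theorem terminationTimes_mono (hE : (protocol m n t ε exVal furthest).IsExecution faulty x E)
    (hi : i ∉ faulty) : Monotone fun k => (E.state k i).terminationTimes :=
  monotone_nat_of_le_succ fun k => by
    obtain ⟨got, hs, -⟩ := exists_step hE hi k
    exact hs.terminationTimes_le

theorem rank_mono (hE : (protocol m n t ε exVal furthest).IsExecution faulty x E)
    (hi : i ∉ faulty) : Monotone fun k => (E.state k i).phase.rank :=
  monotone_nat_of_le_succ fun k => by
    obtain ⟨got, hs, -⟩ := exists_step hE hi k
    exact hs.rank_le

theorem r_mono (hnt : 3 * t + 1 ≤ n)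
    (hE : (protocol m n t ε exVal furthest).IsExecution faulty x E)
    (hi : i ∉ faulty) : Monotone fun k => (E.state k i).r :=
  monotone_nat_of_le_succ fun k => by
    obtain ⟨got, hs, -⟩ := exists_step hE hi k
    exact (inv_state hnt hE hi k).r_le hs

theorem v_zero_eq (hE : (protocol m n t ε exVal furthest).IsExecution faulty x E)
    (hi : i ∉ faulty) (k : ℕ) : (E.state k i).v 0 = x i := by
  induction k with
  | zero => rw [hE.starts i hi]; rfl
  | succ k ih =>
    obtain ⟨got, hs, -⟩ := exists_step hE hi k
    rw [hs.v_zero, ih]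

theorem eventually_mem_senders {k : ℕ} {τ : Tag} (h : j ∈ senders exVal E k i τ) :
    ∀ᶠ l in atTop, j ∈ senders exVal E l i τ :=
  (eventually_ge_atTop k).mono fun _ hl => senders_mono i τ hl h

theorem eventually_mem_senders_of_isImmediate (hlive : ∀ k, (E.state k i).phase ≠ .done)
    {k : ℕ} {M : Msg m} (hM : M.IsImmediate exVal) (h : E.Receives k i j M) :
    ∀ᶠ l in atTop, j ∈ senders exVal E l i M.tag :=
  eventually_mem_senders (mem_senders.2 ⟨k, k.lt_succ_self, M, rfl, .inl ⟨h, hlive k, hM⟩⟩)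

/-- If the message were never accepted, it would wait forever and from some time on be continuously
enabled, contradicting fairness. -/
theorem eventually_mem_senders_of_isStored
    (hE : (protocol m n t ε exVal furthest).IsExecution faulty x E) (hi : i ∉ faulty)
    (hlive : ∀ k, (E.state k i).phase ≠ .done) {k : ℕ} {M : Msg m} (hM : M.IsStored)
    (h : E.Receives k i j M)
    (hen : ∀ᶠ l in atTop, (j, M) ∈ (E.state l i).waiting →
      Enabled t furthest (E.state l i) (.accept j M)) :
    ∀ᶠ l in atTop, j ∈ senders exVal E l i M.tag := by
  by_cases hacc : ∃ l, E.event l = .act i (.accept j M)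
  · obtain ⟨l, hl⟩ := hacc
    exact eventually_mem_senders (mem_senders.2 ⟨l, l.lt_succ_self, M, rfl, .inr hl⟩)
  · obtain ⟨k', hk'⟩ := eventually_atTop.1 hen
    obtain ⟨l, -, hl⟩ := hE.fair i hi (.accept j M) (max (k + 1) k') fun l hl =>
      hk' l ((le_max_right _ _).trans hl) ((mem_waiting_iff hE hi l j M).2
        ⟨hM, ⟨k, (le_max_left _ _).trans hl, h, hlive k⟩, fun ⟨l', _, h'⟩ => hacc ⟨l', h'⟩⟩)
    exact absurd ⟨l, hl⟩ hacc

theorem Collects.le_of_senders_subset {α : Type*} {f : State m n → Multiset α} {τ : Tag}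
    {g : Msg m → α} (hf : Collects n t ε exVal furthest f τ g)
    (hE : (protocol m n t ε exVal furthest).IsExecution faulty x E) (hi : i ∉ faulty)
    (hi' : i' ∉ faulty) {l : ℕ}
    (h : ∀ j ∈ senders exVal E l i' τ, ∀ᶠ k in atTop, j ∈ senders exVal E k i τ) :
    ∀ᶠ k in atTop, f (E.state l i') ≤ f (E.state k i) := by
  have h1 := (eventually_all_finset (senders exVal E l i' τ)).2 h
  filter_upwards [h1] with k hk
  rw [hf.eq_map hE hi, hf.eq_map hE hi']
  exact Multiset.map_le_map (Finset.val_le_iff.2 hk)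

theorem Collects.eventually_le_card {α : Type*} {f : State m n → Multiset α} {τ : Tag}
    {g : Msg m → α} (hf : Collects n t ε exVal furthest f τ g)
    (hE : (protocol m n t ε exVal furthest).IsExecution faulty x E) (hcard : faulty.card ≤ t)
    (hi : i ∉ faulty) (h : ∀ j ∉ faulty, ∀ᶠ k in atTop, j ∈ senders exVal E k i τ) :
    ∀ᶠ k in atTop, n - t ≤ (f (E.state k i)).card := by
  classical
  have h1 := (eventually_all_finset faultyᶜ).2 fun j hj => h j (Finset.mem_compl.1 hj)
  filter_upwards [h1] with k hk
  rw [hf.card_eq hE hi]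
  have h2 : faultyᶜ ⊆ senders exVal E k i τ := hk
  have h3 := Finset.card_le_card h2
  rw [Finset.card_compl, Fintype.card_fin] at h3
  omega

theorem eventually_phase_ne_start
    (hE : (protocol m n t ε exVal furthest).IsExecution faulty x E) (hi : i ∉ faulty) :
    ∀ᶠ k in atTop, (E.state k i).phase ≠ .start := by
  obtain ⟨k, hk⟩ : ∃ k, (E.state k i).phase ≠ .start := by
    by_contra! h
    obtain ⟨l, -, hl⟩ := hE.fair i hi .begin 0 fun l _ => h l
    have h1 := h (l + 1)
    rw [hE.follows l i hi, hl] at h1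
    simp [BroadcastProtocol.react, protocol, perform] at h1
  filter_upwards [eventually_ge_atTop k] with l hl h
  have h1 : (E.state k i).phase.rank ≤ (E.state l i).phase.rank := rank_mono hE hi hl
  rw [h] at h1
  cases h2 : (E.state k i).phase <;> simp_all [Phase.rank]

theorem eventually_le_card_vals (hE : (protocol m n t ε exVal furthest).IsExecution faulty x E)
    (hi : i ∉ faulty) {c k s : ℕ} (h : c ≤ ((E.state k i).vals s).card) :
    ∀ᶠ l in atTop, c ≤ ((E.state l i).vals s).card :=
  (eventually_ge_atTop k).mono fun _ hl =>
    h.trans (Multiset.card_le_card (vals_mono hE hi hl s))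

theorem eventually_le_card_reps (hE : (protocol m n t ε exVal furthest).IsExecution faulty x E)
    (hi : i ∉ faulty) {c k s : ℕ} (h : c ≤ ((E.state k i).reps s).card) :
    ∀ᶠ l in atTop, c ≤ ((E.state l i).reps s).card :=
  (eventually_ge_atTop k).mono fun _ hl =>
    h.trans (Multiset.card_le_card (reps_mono hE hi hl s))

theorem eventually_mem_senders_report (hnt : 3 * t + 1 ≤ n)
    (hE : (protocol m n t ε exVal furthest).IsExecution faulty x E) (hi : i ∉ faulty)
    (hlive : ∀ k, (E.state k i).phase ≠ .done) {s k l : ℕ}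
    {A : Multiset (EuclideanSpace ℝ (Fin m))} (h : E.Receives k i j (.report A s))
    (hA : ReportMessageReady t (E.state l i') A s)
    (hvals : ∀ᶠ k in atTop, (E.state l i').vals s ≤ (E.state k i).vals s)
    (hr : ∀ᶠ k in atTop, s ≤ (E.state k i).r) :
    ∀ᶠ k in atTop, j ∈ senders exVal E k i (.report s) := by
  refine eventually_mem_senders_of_isStored hE hi hlive (M := .report A s) trivial h ?_
  filter_upwards [hvals, hr, eventually_phase_ne_start hE hi] with k h1 h2 h3 h4
  refine ⟨h4, ?_, hA.mono h2 h1⟩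
  -- During the initialization `r = 0`, so `s ≤ r` forces `s = 0`, the only round whose reports are
  -- processed in that phase.
  have h5 := (inv_state hnt hE hi k).r_eq_zero
  have h6 := hlive k
  cases hp : (E.state k i).phase with
  | start => exact absurd hp h3
  | done => exact absurd hp h6
  | main => exact .inr rfl
  | init =>
    rw [hp] at h5
    exact .inl ⟨rfl, by have := h5 le_rfl; omega⟩

theorem phase_eq_main (hnt : 3 * t + 1 ≤ n)
    (hE : (protocol m n t ε exVal furthest).IsExecution faulty x E) (hi : i ∉ faulty)
    {k : ℕ} (hlive : (E.state k i).phase ≠ .done) (hr : 1 ≤ (E.state k i).r) :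
    (E.state k i).phase = .main := by
  have h5 := (inv_state hnt hE hi k).r_eq_zero
  cases hp : (E.state k i).phase <;> simp_all [Phase.rank]

theorem eventually_mem_senders_value (hnt : 3 * t + 1 ≤ n)
    (hE : (protocol m n t ε exVal furthest).IsExecution faulty x E) (hi : i ∉ faulty)
    (hlive : ∀ k, (E.state k i).phase ≠ .done) {s k l : ℕ} {v : EuclideanSpace ℝ (Fin m)}
    {A : Multiset (EuclideanSpace ℝ (Fin m))}
    {R : Multiset (Multiset (EuclideanSpace ℝ (Fin m)))}
    (h : E.Receives k i j (.value v A R (s + 1)))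
    (hA : ValueMessageReady t furthest (E.state l i') v A R (s + 1))
    (hvals : ∀ᶠ k in atTop, (E.state l i').vals s ≤ (E.state k i).vals s)
    (hreps : ∀ᶠ k in atTop, (E.state l i').reps s ≤ (E.state k i).reps s)
    (hr : ∀ᶠ k in atTop, s + 1 ≤ (E.state k i).r) :
    ∀ᶠ k in atTop, j ∈ senders exVal E k i (.value (s + 1)) := by
  refine eventually_mem_senders_of_isStored hE hi hlive (M := .value v A R (s + 1)) trivial h ?_
  filter_upwards [hvals, hreps, hr] with k h1 h2 h3 h4
  exact ⟨h4, phase_eq_main hnt hE hi (hlive k) (by omega), hA.mono h3 h1 h2⟩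

/-- A node that does not terminate eventually incorporates everything that some other nonfaulty
node has incorporated, up to the rounds that it reaches. -/
theorem eventually_vals_le_and_reps_le (hnt : 3 * t + 1 ≤ n)
    (hE : (protocol m n t ε exVal furthest).IsExecution faulty x E) (hi : i ∉ faulty)
    (hlive : ∀ k, (E.state k i).phase ≠ .done) (s : ℕ)
    (hr : ∀ᶠ k in atTop, s ≤ (E.state k i).r) {i' : Fin n} (hi' : i' ∉ faulty) (l : ℕ) :
    (∀ᶠ k in atTop, (E.state l i').vals s ≤ (E.state k i).vals s) ∧
      ∀ᶠ k in atTop, (E.state l i').reps s ≤ (E.state k i).reps s := by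
  -- Values of round `s + 1` depend on values and reports of round `s`, and reports depend on values
  -- of their own round; this is the order of the induction. Each message is judged at the time `l'`
  -- when the other node incorporated it.
  induction s generalizing l with
  | zero =>
    have hv (l : ℕ) : ∀ᶠ k in atTop, (E.state l i').vals 0 ≤ (E.state k i).vals 0 := by
      refine (collects_vals 0).le_of_senders_subset hE hi hi' fun j hj => ?_
      obtain ⟨l', -, M, hM, h⟩ := mem_senders.1 hj
      obtain ⟨p, -, hp⟩ := h.exists_receives hE hi'
      obtain ⟨q, hq⟩ := hE.liveness i' hi' i hi j M p hp
      rw [← hM]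
      refine eventually_mem_senders_of_isImmediate hlive ?_ hq
      obtain ⟨v, rfl⟩ := Msg.eq_initValue_of_tag hM
      rcases h with h | h
      · exact h.2.2
      · exact (hE.allowed _ i' hi' _ h).elim
    refine ⟨hv l, (collects_reps 0).le_of_senders_subset hE hi hi' fun j hj => ?_⟩
    obtain ⟨l', -, M, hM, h⟩ := mem_senders.1 hj
    obtain ⟨p, -, hp⟩ := h.exists_receives hE hi'
    obtain ⟨q, hq⟩ := hE.liveness i' hi' i hi j M p hp
    obtain ⟨A, rfl⟩ := Msg.eq_report_of_tag hM
    exact eventually_mem_senders_report hnt hE hi hlive hq (h.reportMessageReady hE hi') (hv l') hr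
  | succ s ih =>
    have ih' := fun l => ih (hr.mono fun k hk => by omega) l
    have hv (l : ℕ) : ∀ᶠ k in atTop, (E.state l i').vals (s + 1) ≤ (E.state k i).vals (s + 1) := by
      refine (collects_vals (s + 1)).le_of_senders_subset hE hi hi' fun j hj => ?_
      obtain ⟨l', -, M, hM, h⟩ := mem_senders.1 hj
      obtain ⟨p, -, hp⟩ := h.exists_receives hE hi'
      obtain ⟨q, hq⟩ := hE.liveness i' hi' i hi j M p hp
      obtain ⟨v, A, R, rfl⟩ := Msg.eq_value_of_tag hM
      exact eventually_mem_senders_value hnt hE hi hlive hq (h.valueMessageReady hE hi')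
        (ih' l').1 (ih' l').2 hr
    refine ⟨hv l, (collects_reps (s + 1)).le_of_senders_subset hE hi hi' fun j hj => ?_⟩
    obtain ⟨l', -, M, hM, h⟩ := mem_senders.1 hj
    obtain ⟨p, -, hp⟩ := h.exists_receives hE hi'
    obtain ⟨q, hq⟩ := hE.liveness i' hi' i hi j M p hp
    obtain ⟨A, rfl⟩ := Msg.eq_report_of_tag hM
    exact eventually_mem_senders_report hnt hE hi hlive hq (h.reportMessageReady hE hi') (hv l') hr

theorem eventually_terminationTimes_le
    (hE : (protocol m n t ε exVal furthest).IsExecution faulty x E) (hi : i ∉ faulty)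
    (hlive : ∀ k, (E.state k i).phase ≠ .done) (hi' : i' ∉ faulty) (l : ℕ) :
    ∀ᶠ k in atTop, (E.state l i').terminationTimes ≤ (E.state k i).terminationTimes := by
  refine collects_terminationTimes.le_of_senders_subset hE hi hi' fun j hj => ?_
  obtain ⟨l', -, M, hM, h⟩ := mem_senders.1 hj
  obtain ⟨p, -, hp⟩ := h.exists_receives hE hi'
  obtain ⟨q, hq⟩ := hE.liveness i' hi' i hi j M p hp
  rw [← hM]
  refine eventually_mem_senders_of_isImmediate hlive ?_ hq
  obtain ⟨e, rfl⟩ := Msg.eq_enough_of_tag hM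
  trivial

theorem exists_receives_of_mem_sentBefore
    (hE : (protocol m n t ε exVal furthest).IsExecution faulty x E) (hi : i ∉ faulty)
    (hj : j ∉ faulty) {k : ℕ} {M : Msg m}
    (h : M ∈ sentBefore t ε exVal furthest E k j) : ∃ l, E.Receives l i j M := by
  obtain ⟨l, -, h⟩ := h
  exact hE.validity_sent i hi j hj M l h

theorem eventually_le_card_vals_zero (hnt : 3 * t + 1 ≤ n) (hcard : faulty.card ≤ t)
    (hE : (protocol m n t ε exVal furthest).IsExecution faulty x E)
    (hx : ∀ i ∉ faulty, exVal (x i) = true) (hi : i ∉ faulty) :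
    ∀ᶠ k in atTop, n - t ≤ ((E.state k i).vals 0).card := by
  by_cases hlive : ∀ k, (E.state k i).phase ≠ .done
  · refine (collects_vals 0).eventually_le_card hE hcard hi fun j hj => ?_
    obtain ⟨k, hk⟩ := (eventually_phase_ne_start hE hj).exists
    have h1 := (inv_state hnt hE hj k).init_sent hk
    rw [v_zero_eq hE hj] at h1
    obtain ⟨l, hl⟩ := exists_receives_of_mem_sentBefore hE hi hj h1
    exact eventually_mem_senders_of_isImmediate hlive (M := .initValue (x j)) (hx j hj) hl
  -- A terminated node no longer collects anything, but it passed through round 0 and holds the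
  -- quorum already.
  · push Not at hlive
    obtain ⟨k, hk⟩ := hlive
    have hI := inv_state hnt hE hi k
    have h1 := hI.le_card_reps 0 (hI.r_pos (by simp [hk, Phase.rank]))
    exact eventually_le_card_vals hE hi (hI.le_card_vals (by omega) h1)

theorem eventually_le_card_reps_of_vals (hnt : 3 * t + 1 ≤ n) (hcard : faulty.card ≤ t)
    (hE : (protocol m n t ε exVal furthest).IsExecution faulty x E) {s : ℕ}
    (hvals : ∀ j ∉ faulty, ∀ᶠ k in atTop, n - t ≤ ((E.state k j).vals s).card)
    (hi : i ∉ faulty) (hr : ∀ᶠ k in atTop, s ≤ (E.state k i).r)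
    (hdone : ∀ k, (E.state k i).phase = .done → s < (E.state k i).r) :
    ∀ᶠ k in atTop, n - t ≤ ((E.state k i).reps s).card := by
  by_cases hlive : ∀ k, (E.state k i).phase ≠ .done
  · refine (collects_reps s).eventually_le_card hE hcard hi fun j hj => ?_
    obtain ⟨k, hk⟩ := (hvals j hj).exists
    obtain ⟨A, h1, h2⟩ := (inv_state hnt hE hj k).report_sent s hk
    obtain ⟨l, hl⟩ := exists_receives_of_mem_sentBefore hE hi hj h1
    exact eventually_mem_senders_report hnt hE hi hlive hl h2
      (eventually_vals_le_and_reps_le hnt hE hi hlive s hr hj k).1 hr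
  · push Not at hlive
    obtain ⟨k, hk⟩ := hlive
    exact eventually_le_card_reps hE hi ((inv_state hnt hE hi k).le_card_reps s (hdone k hk))

theorem eventually_le_card_reps_zero (hnt : 3 * t + 1 ≤ n) (hcard : faulty.card ≤ t)
    (hE : (protocol m n t ε exVal furthest).IsExecution faulty x E)
    (hx : ∀ i ∉ faulty, exVal (x i) = true) (hi : i ∉ faulty) :
    ∀ᶠ k in atTop, n - t ≤ ((E.state k i).reps 0).card :=
  eventually_le_card_reps_of_vals hnt hcard hE
    (fun j hj => eventually_le_card_vals_zero hnt hcard hE hx hj) hi (.of_forall fun _ => Nat.zero_le _)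
    fun k hk => (inv_state hnt hE hi k).r_pos (by simp [hk, Phase.rank])

theorem eventually_le_card_terminationTimes (hnt : 3 * t + 1 ≤ n) (hcard : faulty.card ≤ t)
    (hE : (protocol m n t ε exVal furthest).IsExecution faulty x E)
    (hx : ∀ i ∉ faulty, exVal (x i) = true) (hi : i ∉ faulty)
    (hlive : ∀ k, (E.state k i).phase ≠ .done) :
    ∀ᶠ k in atTop, n - t ≤ (E.state k i).terminationTimes.card := by
  refine collects_terminationTimes.eventually_le_card hE hcard hi fun j hj => ?_
  obtain ⟨k, hk⟩ := (eventually_le_card_reps_zero hnt hcard hE hx hj).exists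
  obtain ⟨l, hl⟩ := exists_receives_of_mem_sentBefore hE hi hj
    ((inv_state hnt hE hj k).enough_sent hk)
  exact eventually_mem_senders_of_isImmediate hlive (M := .enough _) trivial hl

theorem eventually_le_r (hnt : 3 * t + 1 ≤ n)
    (hE : (protocol m n t ε exVal furthest).IsExecution faulty x E) (hi : i ∉ faulty)
    {k s : ℕ} (h : s ≤ (E.state k i).r) : ∀ᶠ l in atTop, s ≤ (E.state l i).r :=
  (eventually_ge_atTop k).mono fun _ hl => h.trans (r_mono hnt hE hi hl)

/-- A node staying forever in round 0 would be alive, hence collect quorums of reports and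
estimates, and the step into the main loop would remain enabled. -/
theorem eventually_one_le_r (hnt : 3 * t + 1 ≤ n) (hcard : faulty.card ≤ t)
    (hE : (protocol m n t ε exVal furthest).IsExecution faulty x E)
    (hx : ∀ i ∉ faulty, exVal (x i) = true) (hi : i ∉ faulty) :
    ∀ᶠ k in atTop, 1 ≤ (E.state k i).r := by
  by_contra hcon
  have hr : ∀ k, ¬ 2 ≤ (E.state k i).phase.rank := fun k hk =>
    hcon (eventually_le_r hnt hE hi ((inv_state hnt hE hi k).r_pos hk))
  have hlive : ∀ k, (E.state k i).phase ≠ .done := fun k hk => hr k (by simp [hk, Phase.rank])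
  obtain ⟨k, hk⟩ := eventually_atTop.1 ((eventually_phase_ne_start hE hi).and
    ((eventually_le_card_reps_zero hnt hcard hE hx hi).and
      (eventually_le_card_terminationTimes hnt hcard hE hx hi hlive)))
  obtain ⟨l, -, hl⟩ := hE.fair i hi .enterMain k fun l hl => by
    obtain ⟨h1, h2, h3⟩ := hk l hl
    refine ⟨?_, h3, h2⟩
    have h4 := hr l
    cases hp : (E.state l i).phase <;> simp_all [Phase.rank]
  have h1 := hr (l + 1)
  rw [hE.follows l i hi, hl] at h1
  simp [BroadcastProtocol.react, protocol, perform, Phase.rank] at h1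

/-- By `hdone`, terminated nodes had passed round `s + 1`, so they have broadcast their vote and
report for it. Every live node therefore gathers `n - t` votes and then `n - t` reports, which by
`card_reps_lt` cannot remain in the current round. -/
theorem eventually_succ_le_r (hnt : 3 * t + 1 ≤ n) (hcard : faulty.card ≤ t)
    (hE : (protocol m n t ε exVal furthest).IsExecution faulty x E) {s : ℕ}
    (hr : ∀ i ∉ faulty, ∀ᶠ k in atTop, s + 1 ≤ (E.state k i).r)
    (hdone : ∀ i ∉ faulty, ∀ k, (E.state k i).phase = .done → s + 1 < (E.state k i).r)
    (hi : i ∉ faulty) : ∀ᶠ k in atTop, s + 2 ≤ (E.state k i).r := by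
  have hvals : ∀ i ∉ faulty, ∀ᶠ k in atTop, n - t ≤ ((E.state k i).vals (s + 1)).card := by
    intro i hi
    by_cases hlive : ∀ k, (E.state k i).phase ≠ .done
    · refine (collects_vals (s + 1)).eventually_le_card hE hcard hi fun j hj => ?_
      obtain ⟨k, hk⟩ := (hr j hj).exists
      obtain ⟨v, A, R, h1, h2, -⟩ := (inv_state hnt hE hj k).value_sent (s + 1) (by omega) hk
      obtain ⟨l, hl⟩ := exists_receives_of_mem_sentBefore hE hi hj h1
      obtain ⟨h3, h4⟩ := eventually_vals_le_and_reps_le hnt hE hi hlive s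
        ((hr i hi).mono fun k hk => by omega) hj k
      exact eventually_mem_senders_value hnt hE hi hlive hl h2 h3 h4 (hr i hi)
    · push Not at hlive
      obtain ⟨k, hk⟩ := hlive
      have hI := inv_state hnt hE hi k
      exact eventually_le_card_vals hE hi
        (hI.le_card_vals (by omega) (hI.le_card_reps _ (hdone i hi k hk)))
  filter_upwards [hr i hi,
    eventually_le_card_reps_of_vals hnt hcard hE hvals hi (hr i hi) (hdone i hi)] with k h1 h2
  by_contra h3
  have h4 := (inv_state hnt hE hi k).card_reps_lt (by omega)
  rw [show (E.state k i).r = s + 1 by omega] at h4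
  omega

theorem eventually_le_r_of_done (hnt : 3 * t + 1 ≤ n) (hcard : faulty.card ≤ t)
    (hE : (protocol m n t ε exVal furthest).IsExecution faulty x E)
    (hx : ∀ i ∉ faulty, exVal (x i) = true) (s : ℕ)
    (hdone : ∀ i ∉ faulty, ∀ k, (E.state k i).phase = .done → s + 1 ≤ (E.state k i).r)
    {i : Fin n} (hi : i ∉ faulty) : ∀ᶠ k in atTop, s + 1 ≤ (E.state k i).r := by
  induction s generalizing i with
  | zero => exact eventually_one_le_r hnt hcard hE hx hi
  | succ s ih =>
    exact eventually_succ_le_r hnt hcard hE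
      (fun i hi => ih (fun i hi k hk => by have := hdone i hi k hk; omega) hi)
      (fun i hi k hk => by have := hdone i hi k hk; omega) hi

/-- Having more than `t` entries at most `s + 1` passes to larger multisets, so `halt` stays at most
`s + 1` from some time on and terminating remains enabled. -/
theorem exists_phase_eq_done (hnt : 3 * t + 1 ≤ n)
    (hE : (protocol m n t ε exVal furthest).IsExecution faulty x E) (hi : i ∉ faulty)
    {T : Multiset ℤ} {s : ℕ} (hT : n - t ≤ T.card)
    (hs : t < (T.filter (· ≤ ((s + 1 : ℕ) : ℤ))).card)
    (hle : ∀ᶠ k in atTop, T ≤ (E.state k i).terminationTimes)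
    (hr : ∀ᶠ k in atTop, s + 1 ≤ (E.state k i).r) : ∃ k, (E.state k i).phase = .done := by
  by_contra! hlive
  obtain ⟨k, hk⟩ := eventually_atTop.1 (hle.and hr)
  obtain ⟨l, -, hl⟩ := hE.fair i hi .terminate k fun l hl => by
    obtain ⟨h1, h2⟩ := hk l hl
    refine ⟨phase_eq_main hnt hE hi (hlive l) (by omega), ?_⟩
    have h3 := hT.trans (Multiset.card_le_card h1)
    rw [(inv_state hnt hE hi l).halt_eq, if_pos h3, WithTop.coe_le_coe]
    refine ((sort_getD_le_iff _ (by omega) ((s + 1 : ℕ) : ℤ)).2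
      (hs.trans_le (Multiset.card_le_card (Multiset.filter_le_filter _ h1)))).trans ?_
    exact_mod_cast h2
  refine hlive (l + 1) ?_
  rw [hE.follows l i hi, hl]
  simp [BroadcastProtocol.react, protocol, perform]

theorem exists_outputs (hnt : 3 * t + 1 ≤ n) (hcard : faulty.card ≤ t)
    (hE : (protocol m n t ε exVal furthest).IsExecution faulty x E)
    (hx : ∀ i ∉ faulty, exVal (x i) = true) (hi : i ∉ faulty) :
    ∃ y, (protocol m n t ε exVal furthest).Outputs E i y := by
  classical
  suffices h : ∃ k, (E.state k i).phase = .done by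
    obtain ⟨k, hk⟩ := h
    refine ⟨(E.state k i).v (E.state k i).r, k, ?_⟩
    simp only [protocol, hk]
  by_contra! hlive
  -- If some nonfaulty node terminates, the least round of termination is one that every nonfaulty
  -- node reaches. The estimates of the node that stopped there eventually reach `i` and make it
  -- stop as well.
  by_cases hex : ∃ s, ∃ j ∉ faulty, ∃ k, (E.state k j).phase = .done ∧ (E.state k j).r = s
  · have hmin := fun s => Nat.find_min' hex (m := s)
    obtain ⟨j, hj, k, hk, hr⟩ := Nat.find_spec hex
    set s := Nat.find hex
    have hI := inv_state hnt hE hj k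
    obtain ⟨p, hp⟩ : ∃ p, s = p + 1 := Nat.exists_eq_succ_of_ne_zero (by
      have := hI.r_pos (by simp [hk, Phase.rank]); omega)
    have h1 := hI.halt_le hk
    rw [hI.halt_eq] at h1
    split_ifs at h1 with h2
    · rw [WithTop.coe_le_coe, sort_getD_le_iff _ (by omega), hr, hp] at h1
      obtain ⟨l, hl⟩ := exists_phase_eq_done hnt hE hi h2 h1
        (eventually_terminationTimes_le hE hi hlive hj k)
        (eventually_le_r_of_done hnt hcard hE hx p
          (fun i hi k hk => hp ▸ hmin _ ⟨i, hi, k, hk, rfl⟩) hi)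
      exact hlive l hl
    · simp at h1
  -- If nobody terminates, every round is reached. Node `i` can use its own estimates at one time
  -- `k`; `toNat` turns the possibly negative halting value into a round number not below it.
  · obtain ⟨k, hk⟩ := (eventually_le_card_terminationTimes hnt hcard hE hx hi hlive).exists
    set T := (E.state k i).terminationTimes with hT
    set s := ((T.sort (· ≤ ·)).getD t 0).toNat
    obtain ⟨l, hl⟩ := exists_phase_eq_done hnt hE hi (s := s) hk
      ((sort_getD_le_iff T (by omega) _).1 (by push_cast; omega))
      ((eventually_ge_atTop k).mono fun l hl => terminationTimes_mono hE hi hl)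
      (eventually_le_r_of_done hnt hcard hE hx s
        (fun i hi k hk => absurd ⟨_, i, hi, k, hk, rfl⟩ hex) hi)
    exact hlive l hl

end

end ApproxAgreement

theorem mainTheorem1 (m n t : ℕ) (hnt : 3 * t + 1 ≤ n) (ε : ℝ) (hε : 0 < ε)
    (exVal : EuclideanSpace ℝ (Fin m) → Bool)
    (furthest : Multiset (EuclideanSpace ℝ (Fin m)) →
      EuclideanSpace ℝ (Fin m) × EuclideanSpace ℝ (Fin m))
    (hfurthest : ApproxAgreement.IsFurthest furthest) :
    IsValidatedApproxAgreement (ApproxAgreement.protocol m n t ε exVal furthest) exVal ε t := by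
  intro faulty x E hcard hE
  refine ⟨fun hx i hi => ?_, fun i hi j hj y z hy hz => ?_, fun i hi y hy => ?_⟩
  · exact ApproxAgreement.exists_outputs hnt hcard hE hx hi
  · exact ApproxAgreement.dist_outputs_le hnt hε hfurthest hcard hE hi hj hy hz
  · exact ApproxAgreement.outputs_mem_convexHull hnt hcard hE hi hy
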